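/- Let $d\ge 1$, $X,T,\varepsilon,\delta>0$, $\Omega=(0,X)^d$, and let $\rho_\delta:[0,\delta]\to[0,\infty)$ satisfy $\int_{B_\delta(0)}|s|^2\rho_\delta(|s|)\,ds=2d$, where $|\cdot|$ is the Euclidean norm and $B_\delta(0)\subset\mathbb R^d$ the ball of radius $\delta$. Put $$\mathcal L_\delta v(x)=\tfrac12\int_{B_\delta(0)}\rho_\delta(|s|)\bigl(v(x+s)+v(x-s)-2v(x)\bigr)\,ds .$$ Let $C^4_{per}(\overline\Omega)$ be the space of $C^4$ functions on $\mathbb R^d$ that are $X$-periodic in every coordinate, with the $C^4$ norm. Let $u\in C^1([0,T];C^4_{per}(\overline\Omega))$ solve the nonlocal Allen–Cahn equation $$u_t-\varepsilon^2\mathcal L_\delta u+u^3-u=0\ \text{ in }\Omega\times(0,T),\qquad u(\cdot,0)=u_0\ \text{ on }\overline\Omega,\qquad \|u_0\|_{L^\infty(\Omega)}\le 1 .$$ Discretization. Let $N,K\ge1$ be integers, $h=X/N$, $\tau=T/K$, $t_n=n\tau$. For $j\in\mathbb Z^d$ put $s_j=hj$ and let $\psi_j(s)=\prod_{k=1}^d\max(0,1-|s_k/h-j_k|)$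 be the $d$-multilinear nodal basis function. Let $I^h$ be the restriction of periodic functions to the mesh nodes $x_i=hi$, with indices taken modulo $N$. Let $D_h$ be the matrix of the following operator on periodic grid functions, in which only finitely many coefficients are nonzero: $$(D_hV)_i=\sum_{0\ne j\in\mathbb Z^d}\frac{V_{i+j}+V_{i-j}-2V_i}{|s_j|^2}\,\|s_j\|_1\,\beta_j,\qquad \beta_j=\tfrac12\int_{B_\delta(0)}\psi_j(s)\frac{|s|^2}{\|s\|_1}\rho_\delta(|s|)\,ds .$$ Let $\kappa\ge2$, $L_h=-\varepsilon^2D_h+\kappa I$, and $f(U)=(\kappa+1)U-U^{.3}$ with the cube taken entrywise. The ETD1 solution is defined by $U^0=I^hu_0$ and $$U^{n+1}=e^{-L_h\tau}U^n+\int_0^\tau e^{-L_h(\tau-s)}f(U^n)\,ds,\qquad 0\le n<K .$$ Then $$\|U^n-I^hu(t_n)\|_\infty\le C\,e^{t_n}(h^2+\tau),\qquad 0\le n\le K,$$ where $C>0$ depends only on $d$, $\varepsilon$, $\kappa$ and an upper bound $M$ for the $C^1([0,T];C^4_{per}(\overline\Omega))$ norm of $u$. In particular, $C$ is independent of $\delta$,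 $\rho_\delta$, $h$ and $\tau$. -/

import Mathlib

open Set MeasureTheory

namespace NAC

noncomputable section

/-- `ℝ^d` with the Euclidean norm and Lebesgue measure. -/
abbrev Sp (d : ℕ) : Type := EuclideanSpace ℝ (Fin d)

/-- The open cube `Ω = (0, X)^d`. -/
def cube (d : ℕ) (X : ℝ) : Set (Sp d) := {x | ∀ k, x k ∈ Ioo 0 X}

/-- The closed cube `[0, X]^d`, the closure of `Ω`. -/
def closedCube (d : ℕ) (X : ℝ) : Set (Sp d) := {x | ∀ k, x k ∈ Icc 0 X}

/-! ### The space of periodic `C⁴` functions -/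

/-- The functions on `ℝ^d` that are `X`-periodic in every coordinate and of class `C⁴`
(that is, the periodic extensions of the elements of `C⁴_per` on the closed cube). -/
def C4perSubmodule (d : ℕ) (X : ℝ) : Submodule ℝ (Sp d → ℝ) where
  carrier := {u | ContDiff ℝ 4 u ∧ ∀ k x, u (x + EuclideanSpace.single k X) = u x}
  add_mem' := by
    rintro u v ⟨hu, hu'⟩ ⟨hv, hv'⟩
    refine ⟨hu.add hv, fun k x => ?_⟩
    simp [hu', hv']
  zero_mem' := ⟨contDiff_const, fun _ _ => rfl⟩
  smul_mem' := by
    rintro c u ⟨hu, hu'⟩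
    refine ⟨contDiff_const.smul hu, fun k x => ?_⟩
    simp [hu']

/-- The space `C⁴_per`; it carries the `C⁴` norm defined below
(and not the topology of pointwise convergence). -/
def C4per (d : ℕ) (X : ℝ) : Type := C4perSubmodule d X

instance (d : ℕ) (X : ℝ) : AddCommGroup (C4per d X) :=
  inferInstanceAs (AddCommGroup (C4perSubmodule d X))

instance (d : ℕ) (X : ℝ) : Module ℝ (C4per d X) :=
  inferInstanceAs (Module ℝ (C4perSubmodule d X))

instance (d : ℕ) (X : ℝ) : CoeFun (C4per d X) (fun _ => Sp d → ℝ) := ⟨fun u => u.1⟩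

theorem add_lattice {d : ℕ} {X : ℝ} {F : Type*} {g : Sp d → F}
    (hg : ∀ k x, g (x + EuclideanSpace.single k X) = g x) (m : Fin d → ℤ) (x : Sp d) :
    g (x + ∑ k, (m k) • EuclideanSpace.single k X) = g x := by
  have h1 : ∀ (k : Fin d) (n : ℤ) (y : Sp d),
      g (y + n • EuclideanSpace.single k X) = g y := by
    intro k n y
    exact (Function.Periodic.zsmul (f := g) (c := EuclideanSpace.single k X) (hg k) n) y
  have h2 : ∀ (s : Finset (Fin d)) (y : Sp d),
      g (y + ∑ k ∈ s, (m k) • EuclideanSpace.single k X) = g y := by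
    intro s
    induction s using Finset.induction_on with
    | empty => intro y; simp
    | insert a s ha ih =>
      intro y
      rw [Finset.sum_insert ha, ← add_assoc, ih, h1]
  exact h2 _ x

/-- A continuous function that is periodic in every coordinate is bounded. -/
theorem periodic_bounded {d : ℕ} {X : ℝ} (hX : 0 < X) {F : Type*} [NormedAddCommGroup F]
    {g : Sp d → F} (hc : Continuous g)
    (hg : ∀ k x, g (x + EuclideanSpace.single k X) = g x) :
    ∃ C, ∀ x, ‖g x‖ ≤ C := by
  obtain ⟨C, hC⟩ := (isCompact_closedBall (0 : Sp d) (Real.sqrt (d * X ^ 2))).exists_bound_of_continuousOn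
    hc.continuousOn
  refine ⟨C, fun x => ?_⟩
  have hx := add_lattice hg (fun k => -⌊x k / X⌋) x
  rw [← hx]
  apply hC
  rw [mem_closedBall_zero_iff, EuclideanSpace.norm_eq]
  apply Real.sqrt_le_sqrt
  calc _ ≤ ∑ k : Fin d, X ^ 2 := by
        apply Finset.sum_le_sum
        intro k _
        have h0 : (x + ∑ k, (-⌊x k / X⌋) • EuclideanSpace.single k X) k
            = x k - ⌊x k / X⌋ * X := by
          simp [Finset.sum_apply, Pi.single_apply]
          ring
        rw [h0, Real.norm_eq_abs, sq_abs]
        have h1 := Int.floor_le (x k / X)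
        have h2 := Int.lt_floor_add_one (x k / X)
        rw [le_div_iff₀ hX] at h1
        rw [div_lt_iff₀ hX] at h2
        apply pow_le_pow_left₀ <;> nlinarith
    _ = d * X ^ 2 := by simp

theorem iteratedFDeriv_bounded {d : ℕ} {X : ℝ} (hX : 0 < X) (u : C4per d X) (k : Fin 5) :
    ∃ C, ∀ x, ‖iteratedFDeriv ℝ (k : ℕ) u x‖ ≤ C := by
  refine periodic_bounded hX (u.2.1.continuous_iteratedFDeriv ?_) ?_
  · exact_mod_cast Nat.lt_succ_iff.mp k.2
  · intro i x
    rw [← iteratedFDeriv_comp_add_right]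
    congr 1
    funext y
    exact u.2.2 i y

variable {d : ℕ} {X : ℝ} [hX : Fact (0 < X)]

/-- The derivatives of order `0, …, 4` as bounded continuous functions. -/
def jet : C4per d X →ₗ[ℝ]
    ((k : Fin 5) → BoundedContinuousFunction (Sp d)
      (ContinuousMultilinearMap ℝ (fun _ : Fin (k : ℕ) => Sp d) ℝ)) where
  toFun u k := BoundedContinuousFunction.ofNormedAddCommGroup
    (fun x => iteratedFDeriv ℝ (k : ℕ) u x)
    (u.2.1.continuous_iteratedFDeriv (by exact_mod_cast Nat.lt_succ_iff.mp k.2))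
    (iteratedFDeriv_bounded hX.out u k).choose (iteratedFDeriv_bounded hX.out u k).choose_spec
  map_add' u v := by
    funext k
    ext1 x
    have hk : ((k : ℕ) : WithTop ℕ∞) ≤ 4 := by exact_mod_cast Nat.lt_succ_iff.mp k.2
    exact iteratedFDeriv_add_apply (u.2.1.contDiffAt.of_le hk) (v.2.1.contDiffAt.of_le hk)
  map_smul' c u := by
    funext k
    ext1 x
    have hk : ((k : ℕ) : WithTop ℕ∞) ≤ 4 := by exact_mod_cast Nat.lt_succ_iff.mp k.2
    exact iteratedFDeriv_const_smul_apply (u.2.1.contDiffAt.of_le hk)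

theorem jet_apply (u : C4per d X) (k : Fin 5) (x : Sp d) :
    jet u k x = iteratedFDeriv ℝ (k : ℕ) u x := rfl

theorem jet_injective : Function.Injective (jet : C4per d X →ₗ[ℝ] _) := by
  intro u v huv
  apply Subtype.ext
  funext x
  have h : jet u 0 x (fun i => i.elim0) = jet v 0 x (fun i => i.elim0) := by rw [huv]
  exact h

/-- The `C⁴` norm: the maximum over `k ≤ 4` of the suprema of the `k`-th derivative. -/
instance : NormedAddCommGroup (C4per d X) :=
  NormedAddCommGroup.induced (C4per d X) _ jet jet_injective

instance : NormedSpace ℝ (C4per d X) :=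
  NormedSpace.induced ℝ (C4per d X) _ jet

theorem norm_le_iff (u : C4per d X) {M : ℝ} (hM : 0 ≤ M) :
    ‖u‖ ≤ M ↔ ∀ k ≤ 4, ∀ x, ‖iteratedFDeriv ℝ k u x‖ ≤ M := by
  have h : ‖u‖ = ‖jet u‖ := rfl
  rw [h, pi_norm_le_iff_of_nonneg hM]
  constructor
  · intro H k hk x
    exact (BoundedContinuousFunction.norm_le hM).1 (H ⟨k, by omega⟩) x
  · intro H k
    exact (BoundedContinuousFunction.norm_le hM).2 fun x => H k (by omega) x

/-! ### The nonlocal operator and the nonlocal Allen-Cahn equation -/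

/-- `ρ : [0, δ] → ℝ` is an admissible kernel: it is nonnegative and
`∫_{B_δ(0)} |s|² ρ(|s|) ds = 2d`. -/
structure IsKernel (d : ℕ) (δ : ℝ) (ρ : ℝ → ℝ) : Prop where
  nonneg : ∀ r ∈ Icc 0 δ, 0 ≤ ρ r
  integrable : IntegrableOn (fun s : Sp d => ‖s‖ ^ 2 * ρ ‖s‖) (Metric.ball 0 δ)
  moment : ∫ s in Metric.ball (0 : Sp d) δ, ‖s‖ ^ 2 * ρ ‖s‖ = 2 * d

/-- The nonlocal operator
`(𝓛_δ v)(x) = ½ ∫_{B_δ(0)} ρ(|s|) (v(x + s) + v(x - s) - 2 v(x)) ds`. -/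
def nonlocalOp {d : ℕ} (δ : ℝ) (ρ : ℝ → ℝ) (v : Sp d → ℝ) (x : Sp d) : ℝ :=
  (1 / 2) * ∫ s in Metric.ball (0 : Sp d) δ, ρ ‖s‖ * (v (x + s) + v (x - s) - 2 * v x)

/-- `u ∈ C¹([0,T]; C⁴_per)` solves `u_t - ε² 𝓛_δ u + u³ - u = 0` in `Ω × (0,T)` with
`u(·,0) = u₀` on the closed cube; periodicity is part of the type of `u t`.
Values of `u` outside `[0,T]` and of `u₀` outside the closed cube are irrelevant. -/
structure IsSolution {d : ℕ} {X : ℝ} [Fact (0 < X)] (T ε δ : ℝ) (ρ : ℝ → ℝ)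
    (u₀ : Sp d → ℝ) (u : ℝ → C4per d X) : Prop where
  regular : ContDiffOn ℝ 1 u (Icc 0 T)
  equation : ∀ x ∈ cube d X, ∀ t ∈ Ioo 0 T,
    HasDerivAt (fun s => u s x) (ε ^ 2 * nonlocalOp δ ρ (u t) x - (u t x) ^ 3 + u t x) t
  initial : ∀ x ∈ closedCube d X, u 0 x = u₀ x

/-- The norm of `u` in `C¹([0,T]; C⁴_per)` is at most `M`: the `C⁴` norms of `u(t)` and
of `u'(t)` are at most `M` for all `t ∈ [0,T]`. -/
def C1NormLE {d : ℕ} {X : ℝ} [Fact (0 < X)] (T : ℝ) (u : ℝ → C4per d X) (M : ℝ) : Prop :=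
  ∀ t ∈ Icc 0 T, ‖u t‖ ≤ M ∧ ‖derivWithin u (Icc 0 T) t‖ ≤ M

/-! ### The spatial discretization -/

/-- The nodes modulo periodicity. -/
abbrev Grid (d N : ℕ) : Type := Fin d → ZMod N

/-- The point `h j` of the infinite mesh, `j ∈ ℤ^d`. -/
def meshPt {d : ℕ} (h : ℝ) (j : Fin d → ℤ) : Sp d := WithLp.toLp 2 fun k => h * j k

/-- The representative in `[0, X)^d` of a node. -/
def node {d : ℕ} (X : ℝ) (N : ℕ) (i : Grid d N) : Sp d :=
  meshPt (X / N) fun k => ((i k).val : ℤ)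

/-- `I^h`: the restriction of a function to the nodes. -/
def restrict {d : ℕ} (X : ℝ) (N : ℕ) (v : Sp d → ℝ) : Grid d N → ℝ := fun i => v (node X N i)

/-- The vector 1-norm. -/
def oneNorm {d : ℕ} (s : Sp d) : ℝ := ∑ k, |s k|

/-- The piecewise `d`-multilinear nodal basis function of the mesh point `h j`. -/
def hat {d : ℕ} (h : ℝ) (j : Fin d → ℤ) (s : Sp d) : ℝ := ∏ k, max 0 (1 - |s k / h - j k|)

/-- `β_δ(s_j) = ½ ∫_{B_δ(0)} ψ_j(s) (|s|² / ‖s‖₁) ρ(|s|) ds`. -/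
def beta {d : ℕ} (h δ : ℝ) (ρ : ℝ → ℝ) (j : Fin d → ℤ) : ℝ :=
  (1 / 2) * ∫ s in Metric.ball (0 : Sp d) δ, hat h j s * (‖s‖ ^ 2 / oneNorm s) * ρ ‖s‖

/-- The nonzero `j` with `|j_k| ≤ [δ/h] + 1` for all `k`. -/
def stencil (d : ℕ) (h δ : ℝ) : Finset (Fin d → ℤ) :=
  (Fintype.piFinset fun _ : Fin d => Finset.Icc (-(⌊δ / h⌋ + 1)) (⌊δ / h⌋ + 1)).erase 0

/-- The stencil omits no `j ≠ 0` whose basis function meets the ball `B_δ(0)`. -/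
theorem mem_stencil_of_hat_ne_zero {d : ℕ} {h δ : ℝ} (hh : 0 < h) {j : Fin d → ℤ} (hj : j ≠ 0)
    {s : Sp d} (hs : s ∈ Metric.ball (0 : Sp d) δ) (hne : hat h j s ≠ 0) :
    j ∈ stencil d h δ := by
  refine Finset.mem_erase.2 ⟨hj, Fintype.mem_piFinset.2 fun k => ?_⟩
  have h1 : |s k / h - j k| < 1 := by
    by_contra hcon
    exact hne (Finset.prod_eq_zero (Finset.mem_univ k) (max_eq_left (by linarith)))
  have h2 : |s k| < δ :=
    lt_of_le_of_lt (by simpa using PiLp.norm_apply_le s k) (mem_ball_zero_iff.1 hs)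
  have h3 : |s k / h| < δ / h := by
    rw [abs_div, abs_of_pos hh]
    exact div_lt_div_of_pos_right h2 hh
  have h4 := Int.lt_floor_add_one (δ / h)
  rw [abs_lt] at h1 h3
  rw [Finset.mem_Icc]
  have a : (j k : ℝ) < (⌊δ / h⌋ + 1 + 1 : ℤ) := by push_cast; linarith
  have b : ((-(⌊δ / h⌋ + 1) - 1 : ℤ) : ℝ) < j k := by push_cast; linarith
  have a' := Int.cast_lt.1 a
  have b' := Int.cast_lt.1 b
  omega

/-- The coefficient `(‖s_j‖₁ / |s_j|²) β_δ(s_j)`. -/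
def coeff {d : ℕ} (h δ : ℝ) (ρ : ℝ → ℝ) (j : Fin d → ℤ) : ℝ :=
  oneNorm (meshPt h j) / ‖meshPt h j‖ ^ 2 * beta h δ ρ j

/-- The nonlocal stiffness matrix `D_h`, the matrix of `𝓛_{δ,h}` on periodic grid functions. -/
def stiffness {d : ℕ} (h δ : ℝ) (ρ : ℝ → ℝ) (N : ℕ) : Matrix (Grid d N) (Grid d N) ℝ :=
  fun i i' => ∑ j ∈ stencil d h δ, coeff h δ ρ j *
    ((if i' = i + (fun k => (j k : ZMod N)) then 1 else 0)
      + (if i' = i - (fun k => (j k : ZMod N)) then 1 else 0)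
      - 2 * (if i' = i then 1 else 0))

open scoped Matrix in
/-- `D_h` acts as
`(𝓛_{δ,h} V)_i = ∑_{j ≠ 0} (V_{i+j} + V_{i-j} - 2 V_i) / |s_j|² ‖s_j‖₁ β_δ(s_j)`. -/
theorem stiffness_mulVec {d : ℕ} (h δ : ℝ) (ρ : ℝ → ℝ) (N : ℕ) [NeZero N] (V : Grid d N → ℝ)
    (i : Grid d N) :
    (stiffness h δ ρ N *ᵥ V) i = ∑ j ∈ stencil d h δ, coeff h δ ρ j *
      (V (i + fun k => (j k : ZMod N)) + V (i - fun k => (j k : ZMod N)) - 2 * V i) := by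
  simp only [Matrix.mulVec, dotProduct, stiffness, Finset.sum_mul]
  rw [Finset.sum_comm]
  refine Finset.sum_congr rfl fun j _ => ?_
  simp only [mul_assoc, ← Finset.mul_sum]
  congr 1
  simp [sub_mul, add_mul, Finset.sum_add_distrib, Finset.sum_sub_distrib]

/-! ### The first order exponential time differencing scheme -/

/-- `L_h = -ε² D_h + κ I`. -/
def Lh {d : ℕ} (ε κ h δ : ℝ) (ρ : ℝ → ℝ) (N : ℕ) : Matrix (Grid d N) (Grid d N) ℝ :=
  -(ε ^ 2) • stiffness h δ ρ N + κ • (1 : Matrix (Grid d N) (Grid d N) ℝ)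

/-- `f(U) = (κ + 1) U - U^{.3}`, entrywise. -/
def fVec {ι : Type*} (κ : ℝ) (U : ι → ℝ) : ι → ℝ := fun i => (κ + 1) * U i - U i ^ 3

open scoped Matrix in
/-- The ETD1 iterates with time step `τ`: `U⁰ = I^h u₀` and
`U^{n+1} = e^{-L_h τ} U^n + ∫₀^τ e^{-L_h (τ - s)} f(U^n) ds`, where `h = X / N`. -/
def etd1 {d : ℕ} (X ε κ δ : ℝ) (ρ : ℝ → ℝ) (N : ℕ) [NeZero N] (τ : ℝ) (u₀ : Sp d → ℝ) :
    ℕ → (Grid d N → ℝ)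
  | 0 => restrict X N u₀
  | n + 1 =>
    NormedSpace.exp (-(τ • Lh ε κ (X / N) δ ρ N)) *ᵥ etd1 X ε κ δ ρ N τ u₀ n
      + ∫ s in (0 : ℝ)..τ, NormedSpace.exp (-((τ - s) • Lh ε κ (X / N) δ ρ N)) *ᵥ
          fVec κ (etd1 X ε κ δ ρ N τ u₀ n)

end

end NAC

/-! The proof combines consistency and stability in the maximum norm, with constants that see
neither the kernel nor the mesh.

Consistency: the second difference v(x+s) + v(x-s) - 2v(x) splits into the quadratic form
D²v(x)(s,s) and a remainder E = O(|s|⁴). The quadrature is exact on quadratic forms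
(`quadrature_exact`): the second-moment matrices of the kernel and of the coefficients are both
invariant under signed coordinate permutations, hence multiples of the identity, and their traces
agree because multilinear interpolation reproduces ‖s‖₁, whose kinks lie on mesh hyperplanes. For
the remainder, interpolating (E/|s|²)‖s‖₁ costs O(h²)‖s‖₁ (`interpolation_error_le`). This last
factor cancels the 1/‖s‖₁ in `beta`, and integration against |s|²ρ, of total mass 2d, gives O(h²)
uniformly in δ and ρ (`consistency`).

Stability: -L_h is a nonnegative matrix minus a multiple of the identity, so its semigroup contracts
like e^{-κt} (`norm_exp_Lh_mulVec_le`). Since |f| ≤ κ on [-1,1], the iterates stay bounded by 1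
(`norm_etd1_le_one`). The Lipschitz constant κ+1 of f exceeds the decay rate by exactly 1; each step
therefore amplifies the error by at most 1+τ, whence the factor e^{t_n}.

No maximum principle for u is needed. The constant κ+1 remains valid when one argument lies in
[-1,1] and the other in [-7/5,7/5], so the induction in `error_le_of_small` runs while the error
bound is at most 2/5. Beyond that, the trivial bound 1+M is already of the required size. -/

namespace NAC

/-! ### Matrix semigroups in the maximum norm -/

section Semigroup

open scoped Matrix
open NormedSpace (exp)

attribute [local instance] Matrix.linftyOpNormedRing Matrix.linftyOpNormedAlgebra
  Matrix.linftyOpNormedAddCommGroup Matrix.linftyOpNormedSpace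

theorem norm_exp_le_exp_norm {𝔸 : Type*} [NormedRing 𝔸] [NormOneClass 𝔸] [NormedAlgebra ℝ 𝔸]
    [CompleteSpace 𝔸] (x : 𝔸) : ‖exp x‖ ≤ Real.exp ‖x‖ := by
  rw [NormedSpace.exp_eq_tsum ℝ, Real.exp_eq_exp_ℝ, NormedSpace.exp_eq_tsum_div]
  refine tsum_of_norm_bounded (NormedSpace.expSeries_div_summable ‖x‖).hasSum fun n => ?_
  rw [norm_smul, norm_inv, Real.norm_natCast, div_eq_inv_mul]
  exact mul_le_mul_of_nonneg_left (norm_pow_le x n) (by positivity)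

variable {ι : Type*} [Fintype ι] [DecidableEq ι]

theorem linfty_opNorm_le_of_sum_le {A : Matrix ι ι ℝ} {c : ℝ} (hc : 0 ≤ c)
    (h : ∀ i, ∑ j, |A i j| ≤ c) : ‖A‖ ≤ c := by
  rw [Matrix.linfty_opNorm_def]
  lift c to NNReal using hc
  rw [NNReal.coe_le_coe]
  refine Finset.sup_le fun i _ => ?_
  rw [← NNReal.coe_le_coe]
  push_cast
  simpa using h i

/-- If `P` has row sums of absolute values at most `c`, the semigroup generated by
`P - (c + κ) I` contracts at rate `κ` in the maximum norm. -/
theorem norm_exp_mulVec_le [Nonempty ι] {L P : Matrix ι ι ℝ} {c κ : ℝ} (hc : 0 ≤ c)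
    (hP : ∀ i, ∑ j, |P i j| ≤ c) (hL : L = (c + κ) • (1 : Matrix ι ι ℝ) - P)
    {t : ℝ} (ht : 0 ≤ t) (v : ι → ℝ) :
    ‖exp (t • (-L)) *ᵥ v‖ ≤ Real.exp (-(κ * t)) * ‖v‖ := by
  have h0 : ∀ a : ℝ, algebraMap ℝ (Matrix ι ι ℝ) (exp a) = exp (algebraMap ℝ (Matrix ι ι ℝ) a) :=
    fun a => NormedSpace.algebraMap_exp_comm a
  have h1 : t • (-L) = t • P + algebraMap ℝ (Matrix ι ι ℝ) (-(t * (c + κ))) := by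
    rw [hL, Algebra.algebraMap_eq_smul_one]
    module
  -- The scalar part of `-L` commutes with `P` and factors out; the `c` in its exponent cancels the
  -- bound e^{tc} on the other factor.
  have h2 : exp (t • (-L)) = Real.exp (-(t * (c + κ))) • exp (t • P) := by
    rw [h1, Matrix.exp_add_of_commute _ _ (Algebra.commute_algebraMap_right _ _),
      ← h0, ← Real.exp_eq_exp_ℝ, ← Algebra.commutes]
    exact (Algebra.smul_def _ _).symm
  have h3 : ‖exp (t • P)‖ ≤ Real.exp (t * c) := by
    refine (norm_exp_le_exp_norm _).trans (Real.exp_le_exp.2 ?_)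
    rw [norm_smul, Real.norm_of_nonneg ht]
    exact mul_le_mul_of_nonneg_left (linfty_opNorm_le_of_sum_le hc hP) ht
  have h4 : ‖exp (t • (-L))‖ ≤ Real.exp (-(κ * t)) := by
    rw [h2, norm_smul, Real.norm_of_nonneg (Real.exp_pos _).le]
    refine (mul_le_mul_of_nonneg_left h3 (Real.exp_pos _).le).trans ?_
    rw [← Real.exp_add]
    apply le_of_eq
    congr 1
    ring
  exact (Matrix.linfty_opNorm_mulVec _ _).trans
    (mul_le_mul_of_nonneg_right h4 (norm_nonneg _))

/-- The product rule for the integrating factor; integrating it gives the variation of constants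
formula. -/
theorem hasDerivAt_exp_mulVec {L : Matrix ι ι ℝ} {w : ℝ → ι → ℝ} {w' : ι → ℝ} {τ s : ℝ}
    (hw : HasDerivAt w w' s) :
    HasDerivAt (fun r => exp ((τ - r) • (-L)) *ᵥ w r)
      (exp ((τ - s) • (-L)) *ᵥ (w' + L *ᵥ w s)) s := by
  have h1 : HasDerivAt (fun r => exp ((τ - r) • (-L)))
      ((-1 : ℝ) • (exp ((τ - s) • (-L)) * (-L))) s := by
    have h := hasDerivAt_exp_smul_const (𝕂 := ℝ) (-L) (τ - s)
    exact h.scomp s ((hasDerivAt_id s).const_sub τ)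
  let B : Matrix ι ι ℝ →L[ℝ] (ι → ℝ) →L[ℝ] (ι → ℝ) :=
    LinearMap.toContinuousLinearMap
      (LinearMap.toContinuousLinearMap.toLinearMap ∘ₗ Matrix.mulVecBilin ℝ ℝ)
  have h2 : HasDerivAt (fun r => B (exp ((τ - r) • (-L))) (w r))
      (B (exp ((τ - s) • (-L))) w' + B ((-1 : ℝ) • (exp ((τ - s) • (-L)) * (-L))) (w s)) s :=
    B.hasDerivAt_of_bilinear (fun _ => h1) (fun _ => hw)
  have h3 : ∀ A v, B A v = A *ᵥ v := fun _ _ => rfl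
  simp only [h3] at h2
  convert h2 using 1
  simp [Matrix.mulVec_add]

/-- One exponential step against a curve `w` with `F - w' - L w = O(B)`. -/
theorem exponential_step_error {L : Matrix ι ι ℝ} {κ : ℝ} (hκ : 0 < κ)
    (hL : ∀ t : ℝ, 0 ≤ t → ∀ v : ι → ℝ,
      ‖exp (t • (-L)) *ᵥ v‖ ≤ Real.exp (-(κ * t)) * ‖v‖)
    {τ : ℝ} (hτ : 0 ≤ τ) {w w' : ℝ → ι → ℝ} (hw : ContinuousOn w (Icc 0 τ))
    (hw' : ContinuousOn w' (Icc 0 τ)) (hd : ∀ s ∈ Ioo 0 τ, HasDerivAt w (w' s) s)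
    (U F : ι → ℝ) {B : ℝ} (hB : ∀ s ∈ Ioo 0 τ, ‖F - (w' s + L *ᵥ w s)‖ ≤ B) :
    ‖exp (τ • (-L)) *ᵥ U + (∫ s in (0 : ℝ)..τ, exp ((τ - s) • (-L)) *ᵥ F) - w τ‖
      ≤ Real.exp (-(κ * τ)) * ‖U - w 0‖ + (1 - Real.exp (-(κ * τ))) / κ * B := by
  have hcont : Continuous fun s : ℝ => exp ((τ - s) • (-L)) :=
    NormedSpace.exp_continuous.comp (by fun_prop)
  have hmv : ∀ v : ℝ → ι → ℝ, ContinuousOn v (Icc 0 τ) →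
      ContinuousOn (fun s => exp ((τ - s) • (-L)) *ᵥ v s) (Icc 0 τ) := fun v hv =>
    continuousOn_iff_continuous_domRestrict.2
      ((hcont.comp continuous_subtype_val).matrix_mulVec (continuousOn_iff_continuous_domRestrict.1 hv))
  have hmvL : ContinuousOn (fun s => w' s + L *ᵥ w s) (Icc 0 τ) :=
    hw'.add (continuousOn_iff_continuous_domRestrict.2
      (continuous_const.matrix_mulVec (continuousOn_iff_continuous_domRestrict.1 hw)))
  have hint : ∀ v : ℝ → ι → ℝ, ContinuousOn v (Icc 0 τ) →
      IntervalIntegrable (fun s => exp ((τ - s) • (-L)) *ᵥ v s) volume 0 τ := fun v hv =>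
    (hmv v hv).intervalIntegrable_of_Icc hτ
  -- Variation of constants: `w` is itself an exact exponential step, with source w' + Lw.
  -- Subtracting it from the scheme leaves only the initial error and the residual.
  have h1 := intervalIntegral.integral_eq_sub_of_hasDerivAt_of_le hτ (hmv w hw)
    (fun s hs => hasDerivAt_exp_mulVec (hd s hs)) (hint _ hmvL)
  have h2 : exp (τ • (-L)) *ᵥ U + (∫ s in (0 : ℝ)..τ, exp ((τ - s) • (-L)) *ᵥ F) - w τ
      = exp (τ • (-L)) *ᵥ (U - w 0)
        + ∫ s in (0 : ℝ)..τ, exp ((τ - s) • (-L)) *ᵥ (F - (w' s + L *ᵥ w s)) := by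
    have h3 : ∫ s in (0 : ℝ)..τ, exp ((τ - s) • (-L)) *ᵥ (F - (w' s + L *ᵥ w s))
        = (∫ s in (0 : ℝ)..τ, exp ((τ - s) • (-L)) *ᵥ F)
          - ∫ s in (0 : ℝ)..τ, exp ((τ - s) • (-L)) *ᵥ (w' s + L *ᵥ w s) := by
      rw [← intervalIntegral.integral_sub (hint _ continuousOn_const) (hint _ hmvL)]
      simp only [Matrix.mulVec_sub]
    rw [h3, h1, Matrix.mulVec_sub]
    simp
    abel
  rw [h2]
  refine (norm_add_le _ _).trans (add_le_add (hL τ hτ _) ?_)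
  have h4 : ∫ s in (0 : ℝ)..τ, Real.exp (-(κ * (τ - s))) * B
      = (1 - Real.exp (-(κ * τ))) / κ * B := by
    rw [intervalIntegral.integral_mul_const]
    congr 1
    rw [intervalIntegral.integral_eq_sub_of_hasDerivAt
      (f := fun s => Real.exp (-(κ * (τ - s))) / κ)]
    · simp
      ring
    · intro s _
      have h5 : HasDerivAt (fun s => -(κ * (τ - s))) (-(κ * -1)) s :=
        (((hasDerivAt_id s).const_sub τ).const_mul κ).neg
      refine (h5.exp.div_const κ).congr_deriv ?_
      rw [mul_neg_one, neg_neg, mul_div_cancel_right₀ _ hκ.ne']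
    · exact (by fun_prop : Continuous fun s => Real.exp (-(κ * (τ - s)))).intervalIntegrable _ _
  rw [← h4]
  refine intervalIntegral.norm_integral_le_of_norm_le hτ ?_
    ((by fun_prop : Continuous fun s => Real.exp (-(κ * (τ - s))) * B).intervalIntegrable _ _)
  -- The interval of integration contains its right endpoint, where no residual bound is assumed.
  have hne : ∀ᵐ s : ℝ, s ≠ τ := by simp [ae_iff]
  filter_upwards [hne] with s hs hsI
  have hs' : s ∈ Ioo 0 τ := ⟨hsI.1, lt_of_le_of_ne hsI.2 hs⟩
  exact (hL _ (by linarith [hs'.2]) _).trans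
    (mul_le_mul_of_nonneg_left (hB s hs') (Real.exp_pos _).le)

end Semigroup

/-! ### The multilinear interpolation weights -/

section Weights

/-- All `j` with `|j_k| ≤ [δ/h] + 1`: the stencil together with the origin. -/
noncomputable def box (d : ℕ) (h δ : ℝ) : Finset (Fin d → ℤ) :=
  Fintype.piFinset fun _ : Fin d => Finset.Icc (-(⌊δ / h⌋ + 1)) (⌊δ / h⌋ + 1)

theorem stencil_eq_erase (d : ℕ) (h δ : ℝ) : stencil d h δ = (box d h δ).erase 0 := rfl

/-- Only the two hats at the ends of the cell containing `t` survive, so the sum is linear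
interpolation. The strict bound |t| < m keeps both ends in range. -/
theorem sum_hat_one_dim {t : ℝ} {m : ℤ} (ht : |t| < m) (g : ℤ → ℝ) :
    ∑ j ∈ Finset.Icc (-m) m, max 0 (1 - |t - j|) * g j
      = (1 - Int.fract t) * g ⌊t⌋ + Int.fract t * g (⌊t⌋ + 1) := by
  rw [abs_lt] at ht
  have h0 := Int.floor_le t
  have h1 := Int.lt_floor_add_one t
  have hf : Int.fract t = t - ⌊t⌋ := rfl
  have hlo : -m ≤ ⌊t⌋ := Int.le_floor.2 (by push_cast; linarith)
  have hhi : ⌊t⌋ < m := Int.floor_lt.2 (by linarith)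
  have hsub : ({⌊t⌋, ⌊t⌋ + 1} : Finset ℤ) ⊆ Finset.Icc (-m) m := by
    intro j hj
    simp only [Finset.mem_insert, Finset.mem_singleton] at hj
    rw [Finset.mem_Icc]
    omega
  rw [← Finset.sum_subset hsub, Finset.sum_pair (by omega)]
  · push_cast
    rw [abs_of_nonneg (by linarith), abs_of_nonpos (by linarith : t - (⌊t⌋ + 1) ≤ 0),
      max_eq_right (by linarith), max_eq_right (by linarith), hf]
    ring
  · intro j _ hj
    simp only [Finset.mem_insert, Finset.mem_singleton, not_or] at hj
    rw [max_eq_left, zero_mul]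
    rcases lt_or_gt_of_ne hj.1 with h | h
    · have : (j : ℝ) + 1 ≤ ⌊t⌋ := by exact_mod_cast h
      have := le_abs_self (t - j)
      linarith
    · have h' : ⌊t⌋ + 1 + 1 ≤ j := by omega
      have : (⌊t⌋ : ℝ) + 1 + 1 ≤ j := by exact_mod_cast h'
      have := neg_abs_le (t - j)
      linarith

/-- Tensor-product weights integrate out: for a function of one coordinate, all other factors sum to
one. -/
theorem sum_piFinset_prod_mul {d : ℕ} (I : Finset ℤ) (a : Fin d → ℤ → ℝ)
    (ha : ∀ l, ∑ j ∈ I, a l j = 1) (k : Fin d) (g : ℤ → ℝ) :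
    ∑ j ∈ Fintype.piFinset (fun _ : Fin d => I), (∏ l, a l (j l)) * g (j k)
      = ∑ i ∈ I, a k i * g i := by
  have h1 : ∀ j : Fin d → ℤ, (∏ l, a l (j l)) * g (j k)
      = ∏ l, (a l (j l) * if l = k then g (j l) else 1) := by
    intro j
    rw [Finset.prod_mul_distrib, Finset.prod_ite_eq' Finset.univ k (fun l => g (j l))]
    simp
  simp only [h1]
  rw [← Finset.prod_univ_sum (fun _ : Fin d => I)
    (fun l i => a l i * if l = k then g i else 1), Finset.prod_eq_single k]
  · simp
  · intro l _ hl
    simp [hl, ha l]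
  · simp

variable {d : ℕ} {h δ : ℝ} {s : Sp d}

theorem abs_apply_le_norm (s : Sp d) (k : Fin d) : |s k| ≤ ‖s‖ := by
  simpa using PiLp.norm_apply_le s k

theorem abs_div_lt_floor (hh : 0 < h) (hs : ‖s‖ < δ) (k : Fin d) :
    |s k / h| < ((⌊δ / h⌋ + 1 : ℤ) : ℝ) := by
  push_cast
  refine lt_of_le_of_lt ?_ (Int.lt_floor_add_one (δ / h))
  rw [abs_div, abs_of_pos hh]
  exact div_le_div_of_nonneg_right ((abs_apply_le_norm s k).trans hs.le) hh.le

theorem sum_hat_one_dim_one (hh : 0 < h) (hs : ‖s‖ < δ) (k : Fin d) :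
    ∑ j ∈ Finset.Icc (-(⌊δ / h⌋ + 1)) (⌊δ / h⌋ + 1), max 0 (1 - |s k / h - j|) = 1 := by
  have := sum_hat_one_dim (abs_div_lt_floor hh hs k) fun _ => 1
  simpa using this

theorem sum_hat_mul_apply (hh : 0 < h) (hs : ‖s‖ < δ) (k : Fin d) (g : ℤ → ℝ) :
    ∑ j ∈ box d h δ, hat h j s * g (j k)
      = (1 - Int.fract (s k / h)) * g ⌊s k / h⌋ + Int.fract (s k / h) * g (⌊s k / h⌋ + 1) := by
  rw [← sum_hat_one_dim (abs_div_lt_floor hh hs k) g]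
  exact sum_piFinset_prod_mul _ (fun l i => max 0 (1 - |s l / h - i|))
    (sum_hat_one_dim_one hh hs) k g

theorem sum_hat (hh : 0 < h) (hs : ‖s‖ < δ) : ∑ j ∈ box d h δ, hat h j s = 1 := by
  unfold box hat
  rw [← Finset.prod_univ_sum (fun _ : Fin d => Finset.Icc (-(⌊δ / h⌋ + 1)) (⌊δ / h⌋ + 1))
    (fun l i => max 0 (1 - |s l / h - i|))]
  exact Finset.prod_eq_one fun k _ => sum_hat_one_dim_one hh hs k

theorem meshPt_apply (h : ℝ) (j : Fin d → ℤ) (k : Fin d) : meshPt h j k = h * j k := rfl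

theorem sum_hat_smul_meshPt (hh : 0 < h) (hs : ‖s‖ < δ) :
    ∑ j ∈ box d h δ, hat h j s • meshPt h j = s := by
  ext k
  have h1 := sum_hat_mul_apply hh hs k fun i => h * i
  simp only [WithLp.ofLp_sum, Finset.sum_apply, PiLp.smul_apply, smul_eq_mul, meshPt_apply]
  rw [h1]
  have h2 : Int.fract (s k / h) = s k / h - ⌊s k / h⌋ := rfl
  rw [h2]
  push_cast
  field_simp
  ring

/-- The 1-norm is a sum of functions |s_k|, each linear on every mesh cell since its kink sits at a
node; interpolation therefore reproduces it. This is why the scheme carries the weight ‖s‖₁. -/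
theorem sum_hat_mul_oneNorm (hh : 0 < h) (hs : ‖s‖ < δ) :
    ∑ j ∈ box d h δ, hat h j s * oneNorm (meshPt h j) = oneNorm s := by
  simp only [oneNorm, Finset.mul_sum, meshPt_apply]
  rw [Finset.sum_comm]
  refine Finset.sum_congr rfl fun k _ => ?_
  rw [sum_hat_mul_apply hh hs k fun i => |h * i|]
  have h2 : Int.fract (s k / h) = s k / h - ⌊s k / h⌋ := rfl
  have h3 : s k = h * (s k / h) := by field_simp
  rw [h2]
  set t := s k / h with ht
  rw [h3]
  have h0 := Int.floor_le t
  have h1 := Int.lt_floor_add_one t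
  simp only [abs_mul, abs_of_pos hh]
  push_cast
  rcases le_or_gt 0 ⌊t⌋ with hc | hc
  · have hc' : (0 : ℝ) ≤ ⌊t⌋ := by exact_mod_cast hc
    rw [abs_of_nonneg hc', abs_of_nonneg (by linarith), abs_of_nonneg (by linarith : 0 ≤ t)]
    ring
  · have hc' : (⌊t⌋ : ℝ) + 1 ≤ 0 := by exact_mod_cast hc
    rw [abs_of_nonpos (by linarith), abs_of_nonpos hc', abs_of_nonpos (by linarith : t ≤ 0)]
    ring

theorem hat_nonneg (h : ℝ) (j : Fin d → ℤ) (s : Sp d) : 0 ≤ hat h j s :=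
  Finset.prod_nonneg fun _ _ => le_max_left _ _

theorem oneNorm_nonneg (s : Sp d) : 0 ≤ oneNorm s := Finset.sum_nonneg fun _ _ => abs_nonneg _

theorem abs_apply_le_oneNorm (s : Sp d) (k : Fin d) : |s k| ≤ oneNorm s :=
  Finset.single_le_sum (f := fun k => |s k|) (fun _ _ => abs_nonneg _) (Finset.mem_univ k)

theorem norm_le_oneNorm (s : Sp d) : ‖s‖ ≤ oneNorm s := by
  rw [EuclideanSpace.norm_eq]
  refine Real.sqrt_le_iff.2 ⟨oneNorm_nonneg s, ?_⟩
  rw [sq, oneNorm, Finset.sum_mul]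
  refine Finset.sum_le_sum fun k _ => ?_
  rw [Real.norm_eq_abs, sq]
  exact mul_le_mul_of_nonneg_left (abs_apply_le_oneNorm s k) (abs_nonneg _)

theorem oneNorm_sub_le (s y : Sp d) : |oneNorm y - oneNorm s| ≤ oneNorm (y - s) := by
  unfold oneNorm
  rw [← Finset.sum_sub_distrib]
  exact (Finset.abs_sum_le_sum_abs _ _).trans
    (Finset.sum_le_sum fun k _ => abs_abs_sub_abs_le_abs_sub _ _)

theorem oneNorm_zero : oneNorm (0 : Sp d) = 0 := by simp [oneNorm]

theorem oneNorm_pos (hs : s ≠ 0) : 0 < oneNorm s := (norm_pos_iff.2 hs).trans_le (norm_le_oneNorm s)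

theorem continuous_oneNorm : Continuous (oneNorm : Sp d → ℝ) := by
  unfold oneNorm; fun_prop

theorem continuous_hat (h : ℝ) (j : Fin d → ℤ) : Continuous (hat h j : Sp d → ℝ) := by
  unfold hat; fun_prop

theorem abs_sub_le_of_hat_ne_zero (hh : 0 < h) {j : Fin d → ℤ} (hne : hat h j s ≠ 0) (k : Fin d) :
    |(meshPt h j - s) k| ≤ h := by
  have h1 : |s k / h - j k| < 1 := by
    by_contra hcon
    exact hne (Finset.prod_eq_zero (Finset.mem_univ k) (max_eq_left (by linarith)))
  have h2 : (meshPt h j - s) k = -(h * (s k / h - j k)) := by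
    rw [PiLp.sub_apply, meshPt_apply]
    field_simp
    ring
  rw [h2, abs_neg, abs_mul, abs_of_pos hh]
  nlinarith

theorem oneNorm_le_of_abs_le {η : Sp d} (hη : ∀ k, |η k| ≤ h) : oneNorm η ≤ d * h :=
  (Finset.sum_le_sum (g := fun _ => h) fun k _ => hη k).trans (by simp)

/-- Away from the origin, a basis function is at most `‖s‖₁ / h`. -/
theorem hat_div_oneNorm_le (hh : 0 < h) {j : Fin d → ℤ} (hj : j ≠ 0) (s : Sp d) :
    hat h j s / oneNorm s ≤ h⁻¹ := by
  refine div_le_of_le_mul₀ (oneNorm_nonneg s) (by positivity) ?_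
  obtain ⟨k, hk⟩ := Function.ne_iff.1 hj
  have h1 : (1 : ℝ) ≤ |(j k : ℝ)| := by exact_mod_cast Int.one_le_abs hk
  have h2 : hat h j s ≤ max 0 (1 - |s k / h - j k|) := by
    unfold hat
    rw [← Finset.mul_prod_erase _ _ (Finset.mem_univ k)]
    exact mul_le_of_le_one_right (le_max_left _ _) (Finset.prod_le_one
      (fun _ _ => le_max_left _ _) fun _ _ =>
        max_le zero_le_one (sub_le_self _ (abs_nonneg _)))
  refine h2.trans (max_le (mul_nonneg (by positivity) (oneNorm_nonneg s)) ?_)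
  have h3 : |(j k : ℝ)| ≤ |s k / h| + |s k / h - j k| := by
    have := abs_sub (s k / h) (s k / h - j k)
    simpa using this
  have h4 : |s k / h| ≤ h⁻¹ * oneNorm s := by
    rw [abs_div, abs_of_pos hh, div_eq_inv_mul]
    exact mul_le_mul_of_nonneg_left (abs_apply_le_oneNorm s k) (by positivity)
  linarith

theorem meshPt_zero (h : ℝ) : meshPt h (0 : Fin d → ℤ) = 0 := by
  ext k; simp [meshPt]

/-- The partition of unity needs the origin, which the stencil omits; the factor ‖s_j‖₁ makes its
contribution vanish. -/
theorem sum_stencil_eq_sum_box {φ : (Fin d → ℤ) → ℝ} (h0 : φ 0 = 0) :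
    ∑ j ∈ stencil d h δ, φ j = ∑ j ∈ box d h δ, φ j := by
  rw [stencil_eq_erase, Finset.sum_erase _ h0]

end Weights

/-! ### Taylor expansion of the second difference -/

section Taylor

set_option maxSynthPendingDepth 3

variable {V F : Type*} [NormedAddCommGroup V] [NormedSpace ℝ V]
  [NormedAddCommGroup F] [NormedSpace ℝ F]

/-- The mean value inequality on the ball of radius ‖z‖; each use raises the order of vanishing by
one. -/
theorem norm_le_pow_succ_of_hasFDerivAt {f : V → F} {f' : V → V →L[ℝ] F} {c : ℝ} (hc : 0 ≤ c)
    {k : ℕ} (h0 : f 0 = 0) (hf : ∀ z, HasFDerivAt f (f' z) z)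
    (hb : ∀ z, ‖f' z‖ ≤ c * ‖z‖ ^ k) (z : V) : ‖f z‖ ≤ c * ‖z‖ ^ (k + 1) := by
  have h := (convex_closedBall (0 : V) ‖z‖).norm_image_sub_le_of_norm_hasFDerivWithin_le
    (f := f) (f' := f') (C := c * ‖z‖ ^ k) (x := 0) (y := z)
    (fun y _ => (hf y).hasFDerivWithinAt)
    (fun y hy => (hb y).trans (mul_le_mul_of_nonneg_left
      (pow_le_pow_left₀ (norm_nonneg _) (mem_closedBall_zero_iff.1 hy) k) hc))
    (by simp) (by simp)
  rw [h0, sub_zero, sub_zero] at h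
  rwa [pow_succ, ← mul_assoc]

/-- The remainder of the second difference of `v` at `x` after its quadratic part. -/
noncomputable def secondDiffRem (v : V → F) (x z : V) : F :=
  v (x + z) + v (x - z) - (2 : ℝ) • v x - fderiv ℝ (fderiv ℝ v) x z z

theorem hasFDerivAt_comp_const_sub {f : V → F} {f' : V →L[ℝ] F} {x z : V}
    (hf : HasFDerivAt f f' (x - z)) : HasFDerivAt (fun y => f (x - y)) (-f') z := by
  have h : HasFDerivAt (fun y => f (x - y)) (f' ∘L (-ContinuousLinearMap.id ℝ V)) z :=
    hf.comp z ((hasFDerivAt_id z).const_sub x)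
  refine h.congr_fderiv ?_
  ext y
  simp

theorem hasFDerivAt_comp_const_add {f : V → F} {f' : V →L[ℝ] F} {x z : V}
    (hf : HasFDerivAt f f' (x + z)) : HasFDerivAt (fun y => f (x + y)) f' z :=
  hf.comp z ((hasFDerivAt_id z).const_add x)

/-- The remainder and its first two derivatives vanish at the origin, and its third derivative is
D³v(x+z) - D³v(x-z), of size at most 2M‖z‖. Three integrations give all the bounds. -/
theorem secondDiffRem_expansion {v : V → ℝ} (hv : ContDiff ℝ 4 v) {M : ℝ}
    (hM : ∀ x, ‖iteratedFDeriv ℝ 4 v x‖ ≤ M) (x : V) :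
    ∃ (E₁ : V → V →L[ℝ] ℝ) (E₂ : V → V →L[ℝ] V →L[ℝ] ℝ),
      (∀ z, HasFDerivAt (secondDiffRem v x) (E₁ z) z) ∧ (∀ z, HasFDerivAt E₁ (E₂ z) z) ∧
      (∀ z, ‖secondDiffRem v x z‖ ≤ 2 * M * ‖z‖ ^ 4) ∧ (∀ z, ‖E₁ z‖ ≤ 2 * M * ‖z‖ ^ 3) ∧
      ∀ z, ‖E₂ z‖ ≤ 2 * M * ‖z‖ ^ 2 := by
  have hM0 : 0 ≤ M := (norm_nonneg _).trans (hM x)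
  have hc1 : ContDiff ℝ 3 (fderiv ℝ v) := hv.fderiv_right (by norm_num)
  have hc2 : ContDiff ℝ 2 (fderiv ℝ (fderiv ℝ v)) := hc1.fderiv_right (by norm_num)
  have hc3 : ContDiff ℝ 1 (fderiv ℝ (fderiv ℝ (fderiv ℝ v))) := hc2.fderiv_right (by norm_num)
  set D₁ := fderiv ℝ v with hD1
  set D₂ := fderiv ℝ D₁ with hD2
  set D₃ := fderiv ℝ D₂ with hD3
  have hb : ∀ y, ‖fderiv ℝ D₃ y‖ ≤ M := fun y => by
    rw [← norm_iteratedFDeriv_zero (𝕜 := ℝ) (f := fderiv ℝ D₃), norm_iteratedFDeriv_fderiv, hD3,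
      norm_iteratedFDeriv_fderiv, hD2, norm_iteratedFDeriv_fderiv, hD1,
      norm_iteratedFDeriv_fderiv]
    exact hM y
  have d0 : ∀ y, HasFDerivAt v (D₁ y) y := fun y =>
    ((hv.differentiable (by norm_num)) y).hasFDerivAt
  have d1 : ∀ y, HasFDerivAt D₁ (D₂ y) y := fun y =>
    ((hc1.differentiable (by norm_num)) y).hasFDerivAt
  have d2 : ∀ y, HasFDerivAt D₂ (D₃ y) y := fun y =>
    ((hc2.differentiable (by norm_num)) y).hasFDerivAt
  have hsymm : ∀ a b, D₂ x a b = D₂ x b a := fun a b =>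
    second_derivative_symmetric d0 (d1 x) a b
  let E₁ : V → V →L[ℝ] ℝ := fun z => D₁ (x + z) - D₁ (x - z) - (2 : ℝ) • D₂ x z
  let E₂ : V → V →L[ℝ] V →L[ℝ] ℝ := fun z => D₂ (x + z) + D₂ (x - z) - (2 : ℝ) • D₂ x
  have e0 : ∀ z, HasFDerivAt (secondDiffRem v x) (E₁ z) z := fun z => by
    have h1 := (hasFDerivAt_comp_const_add (d0 (x + z))).add
      (hasFDerivAt_comp_const_sub (d0 (x - z)))
    have h2 : HasFDerivAt (fun y => D₂ x y y) _ z :=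
      (D₂ x).hasFDerivAt.clm_apply (hasFDerivAt_id z)
    have h3 := (h1.sub_const ((2 : ℝ) • v x)).sub h2
    refine h3.congr_fderiv ?_
    ext y
    simp [E₁, hsymm y z]
    ring
  have e1 : ∀ z, HasFDerivAt E₁ (E₂ z) z := fun z => by
    have h1 := (hasFDerivAt_comp_const_add (d1 (x + z))).sub
      (hasFDerivAt_comp_const_sub (d1 (x - z)))
    have h3 := h1.sub ((D₂ x).hasFDerivAt.const_smul (2 : ℝ))
    refine h3.congr_fderiv ?_
    simp [E₂]
  have e2 : ∀ z, HasFDerivAt E₂ (D₃ (x + z) - D₃ (x - z)) z := fun z => by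
    have h1 := (hasFDerivAt_comp_const_add (d2 (x + z))).add
      (hasFDerivAt_comp_const_sub (d2 (x - z)))
    have h3 := h1.sub_const ((2 : ℝ) • D₂ x)
    refine h3.congr_fderiv ?_
    simp [sub_eq_add_neg]
  have b3 : ∀ z, ‖D₃ (x + z) - D₃ (x - z)‖ ≤ 2 * M * ‖z‖ ^ 1 := fun z => by
    have h := convex_univ.norm_image_sub_le_of_norm_fderiv_le (𝕜 := ℝ) (f := D₃) (C := M)
      (x := x - z) (y := x + z) (fun y _ => hc3.differentiable (by norm_num) y)
      (fun y _ => hb y) (mem_univ _) (mem_univ _)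
    refine h.trans (le_of_eq ?_)
    have : x + z - (x - z) = (2 : ℝ) • z := by module
    rw [this, norm_smul]
    norm_num
    ring
  have b2 := norm_le_pow_succ_of_hasFDerivAt (by positivity) (by simp [E₂]; module) e2 b3
  have b1 := norm_le_pow_succ_of_hasFDerivAt (by positivity) (by simp [E₁]) e1 b2
  have b0 := norm_le_pow_succ_of_hasFDerivAt (by positivity)
    (by simp [secondDiffRem]; ring) e0 b1
  exact ⟨E₁, E₂, e0, e1, b0, b1, b2⟩

/-- First order Taylor estimate, with a bound on the second derivative on a ball. -/
theorem taylor_one_le {f : V → ℝ} {f₁ : V → V →L[ℝ] ℝ} {f₂ : V → V →L[ℝ] V →L[ℝ] ℝ}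
    (h0 : ∀ z, HasFDerivAt f (f₁ z) z) (h1 : ∀ z, HasFDerivAt f₁ (f₂ z) z) {s η : V} {B : ℝ}
    (hB : ∀ z ∈ Metric.closedBall s ‖η‖, ‖f₂ z‖ ≤ B) :
    |f (s + η) - f s - f₁ s η| ≤ B * ‖η‖ ^ 2 := by
  have hconv := convex_closedBall s ‖η‖
  have hs : s ∈ Metric.closedBall s ‖η‖ := by simp
  have hB0 : 0 ≤ B := (norm_nonneg _).trans (hB s hs)
  have hη : s + η ∈ Metric.closedBall s ‖η‖ := by simp
  have h2 : ∀ z ∈ Metric.closedBall s ‖η‖, ‖f₁ z - f₁ s‖ ≤ B * ‖η‖ := fun z hz =>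
    (hconv.norm_image_sub_le_of_norm_hasFDerivWithin_le
      (fun y _ => (h1 y).hasFDerivWithinAt) hB hs hz).trans
      (mul_le_mul_of_nonneg_left (by simpa [dist_eq_norm] using hz) hB0)
  have h3 := hconv.norm_image_sub_le_of_norm_hasFDerivWithin_le
    (f := fun z => f z - f₁ s z) (f' := fun z => f₁ z - f₁ s)
    (fun y _ => ((h0 y).sub (f₁ s).hasFDerivAt).hasFDerivWithinAt) h2 hs hη
  rw [add_sub_cancel_left, map_add, Real.norm_eq_abs] at h3
  calc _ = |f (s + η) - ((f₁ s) s + (f₁ s) η) - (f s - (f₁ s) s)| := by congr 1; ring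
    _ ≤ _ := h3.trans (le_of_eq (by ring))

end Taylor

section Quotient

set_option maxSynthPendingDepth 3

variable {V : Type*} [NormedAddCommGroup V] [InnerProductSpace ℝ V]

/-- The scalar core of `quotient_taylor`, with S = |s|, n = |η|, a = |s|², b = |s+η|², x = ⟨s,η⟩, E
and e the value and directional derivative at s, and R the Taylor remainder. An exact identity
leaves four terms, bounded with constants 50, 2, 20 and 20. -/
theorem abs_quotient_sub_le {M S n a b x E e R : ℝ} (hM : 0 ≤ M) (hS : 0 < S) (hn : 0 ≤ n)
    (hnS : n ≤ S / 2) (ha : a = S ^ 2) (hb : b = a + 2 * x + n ^ 2) (hb' : S ^ 2 / 4 ≤ b)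
    (hx : |x| ≤ S * n) (hE : |E| ≤ 2 * M * S ^ 4) (he : |e| ≤ 2 * M * S ^ 3 * n)
    (hR : |R| ≤ 5 * M * S ^ 2 * n ^ 2) :
    |(E + e + R) / b - E / a - (e / a - 2 * E * x / a ^ 2)| ≤ 92 * M * n ^ 2 := by
  have ha0 : 0 < a := by rw [ha]; positivity
  have hb0 : 0 < b := lt_of_lt_of_le (by positivity) hb'
  have hab : |a - b| ≤ 5 / 2 * S * n := by
    rw [abs_le] at hx ⊢
    constructor <;> nlinarith
  have key : (E + e + R) / b - E / a - (e / a - 2 * E * x / a ^ 2)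
      = E * (a - b) ^ 2 / (a ^ 2 * b) - E * n ^ 2 / a ^ 2 + e * (a - b) / (a * b) + R / b := by
    have hx' : x = (b - a - n ^ 2) / 2 := by linarith
    rw [hx']
    field_simp
    ring
  have t1 : |E * (a - b) ^ 2 / (a ^ 2 * b)| ≤ 50 * M * n ^ 2 := by
    rw [abs_div, abs_of_pos (by positivity : 0 < a ^ 2 * b), div_le_iff₀ (by positivity), abs_mul,
      abs_pow]
    calc |E| * |a - b| ^ 2 ≤ (2 * M * S ^ 4) * (5 / 2 * S * n) ^ 2 := by gcongr
      _ = 50 * M * n ^ 2 * (a ^ 2 * (S ^ 2 / 4)) := by rw [ha]; ring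
      _ ≤ _ := by gcongr
  have t2 : |E * n ^ 2 / a ^ 2| ≤ 2 * M * n ^ 2 := by
    rw [abs_div, abs_of_pos (by positivity : 0 < a ^ 2), div_le_iff₀ (by positivity), abs_mul,
      abs_of_nonneg (by positivity : 0 ≤ n ^ 2)]
    calc |E| * n ^ 2 ≤ (2 * M * S ^ 4) * n ^ 2 := by gcongr
      _ = _ := by rw [ha]; ring
  have t3 : |e * (a - b) / (a * b)| ≤ 20 * M * n ^ 2 := by
    rw [abs_div, abs_of_pos (by positivity : 0 < a * b), div_le_iff₀ (by positivity), abs_mul]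
    calc |e| * |a - b| ≤ (2 * M * S ^ 3 * n) * (5 / 2 * S * n) := by gcongr
      _ = 20 * M * n ^ 2 * (a * (S ^ 2 / 4)) := by rw [ha]; ring
      _ ≤ _ := by gcongr
  have t4 : |R / b| ≤ 20 * M * n ^ 2 := by
    rw [abs_div, abs_of_pos hb0, div_le_iff₀ hb0]
    calc |R| ≤ 5 * M * S ^ 2 * n ^ 2 := hR
      _ = 20 * M * n ^ 2 * (S ^ 2 / 4) := by ring
      _ ≤ _ := by gcongr
  rw [key]
  rw [abs_le] at t1 t2 t3 t4 ⊢
  constructor <;> linarith [t1.1, t1.2, t2.1, t2.2, t3.1, t3.2, t4.1, t4.2]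

/-- First order Taylor estimate for `E / |·|²` when `E` vanishes to fourth order at the origin. -/
theorem quotient_taylor {E : V → ℝ} {E₁ : V → V →L[ℝ] ℝ} {E₂ : V → V →L[ℝ] V →L[ℝ] ℝ} {M : ℝ}
    (hM : 0 ≤ M) (h0 : ∀ z, HasFDerivAt E (E₁ z) z) (h1 : ∀ z, HasFDerivAt E₁ (E₂ z) z)
    (b0 : ∀ z, ‖E z‖ ≤ 2 * M * ‖z‖ ^ 4) (b1 : ∀ z, ‖E₁ z‖ ≤ 2 * M * ‖z‖ ^ 3)
    (b2 : ∀ z, ‖E₂ z‖ ≤ 2 * M * ‖z‖ ^ 2) {s : V} (hs : s ≠ 0) :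
    ∃ ℓ : V →L[ℝ] ℝ, (∀ η, |ℓ η| ≤ 6 * M * ‖s‖ * ‖η‖) ∧
      ∀ η, ‖η‖ ≤ ‖s‖ / 2 →
        |E (s + η) / ‖s + η‖ ^ 2 - E s / ‖s‖ ^ 2 - ℓ η| ≤ 92 * M * ‖η‖ ^ 2 := by
  have hS : 0 < ‖s‖ := norm_pos_iff.2 hs
  have hb1 : ∀ η, |E₁ s η| ≤ 2 * M * ‖s‖ ^ 3 * ‖η‖ := fun η =>
    ((E₁ s).le_opNorm η).trans (mul_le_mul_of_nonneg_right (b1 s) (norm_nonneg _))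
  -- The witness is the derivative of E/|·|² at s; its two terms contribute 2 and 4 to the constant
  -- 6.
  refine ⟨(‖s‖ ^ 2)⁻¹ • E₁ s - (2 * E s / (‖s‖ ^ 2) ^ 2) • innerSL ℝ s, fun η => ?_,
    fun η hη => ?_⟩
  · have hval : ((‖s‖ ^ 2)⁻¹ • E₁ s - (2 * E s / (‖s‖ ^ 2) ^ 2) • innerSL ℝ s) η
        = E₁ s η / ‖s‖ ^ 2 - 2 * E s * inner ℝ s η / (‖s‖ ^ 2) ^ 2 := by
      simp
      ring
    rw [hval]
    have t1 : |E₁ s η / ‖s‖ ^ 2| ≤ 2 * M * ‖s‖ * ‖η‖ := by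
      rw [abs_div, abs_of_pos (by positivity : 0 < ‖s‖ ^ 2), div_le_iff₀ (by positivity)]
      exact (hb1 η).trans (le_of_eq (by ring))
    have t2 : |2 * E s * inner ℝ s η / (‖s‖ ^ 2) ^ 2| ≤ 4 * M * ‖s‖ * ‖η‖ := by
      rw [abs_div, abs_of_pos (by positivity : 0 < (‖s‖ ^ 2) ^ 2), div_le_iff₀ (by positivity),
        abs_mul, abs_mul, abs_two]
      calc 2 * |E s| * |inner ℝ s η| ≤ 2 * (2 * M * ‖s‖ ^ 4) * (‖s‖ * ‖η‖) := by
            gcongr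
            · exact b0 s
            · exact abs_real_inner_le_norm s η
        _ = _ := by ring
    exact (abs_sub _ _).trans (by linarith)
  · have hR : |E (s + η) - E s - E₁ s η| ≤ 5 * M * ‖s‖ ^ 2 * ‖η‖ ^ 2 := by
      refine taylor_one_le h0 h1 fun z hz => (b2 z).trans ?_
      have hz' : ‖z‖ ≤ 3 / 2 * ‖s‖ := by
        have h2 : ‖z - s‖ ≤ ‖η‖ := by simpa [dist_eq_norm] using hz
        have h3 := norm_le_norm_add_norm_sub' z s
        linarith
      calc 2 * M * ‖z‖ ^ 2 ≤ 2 * M * (3 / 2 * ‖s‖) ^ 2 := by gcongr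
        _ ≤ _ := by nlinarith [mul_nonneg hM (sq_nonneg ‖s‖)]
    have hb : ‖s + η‖ ^ 2 = ‖s‖ ^ 2 + 2 * inner ℝ s η + ‖η‖ ^ 2 := norm_add_sq_real s η
    have hb' : ‖s‖ ^ 2 / 4 ≤ ‖s + η‖ ^ 2 := by
      have h3 : ‖s‖ ≤ ‖s + η‖ + ‖η‖ := by simpa using norm_sub_le (s + η) η
      nlinarith [norm_nonneg (s + η)]
    have h4 := abs_quotient_sub_le hM hS (norm_nonneg η) hη rfl hb hb'
      (abs_real_inner_le_norm s η) (b0 s) (hb1 η) hR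
    refine le_trans (le_of_eq ?_) h4
    congr 1
    simp
    ring

end Quotient

/-! ### The weighted interpolation error -/

section Interpolation

set_option maxSynthPendingDepth 3

variable {d : ℕ} {h δ : ℝ}

/-- Away from the origin, p = E/|·|² is close to an affine function, and interpolation is exact on
affine functions and on ‖·‖₁, so no smoothness of the 1-norm is needed. The factor ‖s‖₁ on the right
compensates the later division by it; d² comes from |s_j - s| ≤ dh. -/
theorem interpolation_error_le (hh : 0 < h) {E : Sp d → ℝ} {E₁ : Sp d → Sp d →L[ℝ] ℝ}
    {E₂ : Sp d → Sp d →L[ℝ] Sp d →L[ℝ] ℝ} {M : ℝ}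
    (hM : 0 ≤ M) (h0 : ∀ z, HasFDerivAt E (E₁ z) z) (h1 : ∀ z, HasFDerivAt E₁ (E₂ z) z)
    (b0 : ∀ z, ‖E z‖ ≤ 2 * M * ‖z‖ ^ 4) (b1 : ∀ z, ‖E₁ z‖ ≤ 2 * M * ‖z‖ ^ 3)
    (b2 : ∀ z, ‖E₂ z‖ ≤ 2 * M * ‖z‖ ^ 2) {s : Sp d} (hs : ‖s‖ < δ) :
    |∑ j ∈ box d h δ, hat h j s * (E (meshPt h j) / ‖meshPt h j‖ ^ 2 * oneNorm (meshPt h j))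
        - E s / ‖s‖ ^ 2 * oneNorm s| ≤ 98 * d ^ 2 * M * h ^ 2 * oneNorm s := by
  set p : Sp d → ℝ := fun y => E y / ‖y‖ ^ 2 with hp
  have hpb : ∀ y, |p y| ≤ 2 * M * ‖y‖ ^ 2 := fun y => by
    rw [hp]
    simp only
    rw [abs_div, abs_of_nonneg (by positivity : 0 ≤ ‖y‖ ^ 2)]
    exact div_le_of_le_mul₀ (by positivity) (by positivity) ((b0 y).trans (le_of_eq (by ring)))
  have hη1 : ∀ j, hat h j s ≠ 0 → oneNorm (meshPt h j - s) ≤ d * h := fun j hj =>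
    oneNorm_le_of_abs_le (abs_sub_le_of_hat_ne_zero hh hj)
  have hη2 : ∀ j, hat h j s ≠ 0 → ‖meshPt h j - s‖ ≤ d * h := fun j hj =>
    (norm_le_oneNorm _).trans (hη1 j hj)
  have hN := sum_hat_mul_oneNorm hh hs
  have hdh : 0 ≤ (d : ℝ) * h := by positivity
  have hs1 := oneNorm_nonneg s
  -- The weights ψ_j(s)‖s_j‖₁ are nonnegative with sum ‖s‖₁, so a bound at the active nodes passes
  -- to the sum with exactly that factor.
  have weighted : ∀ (φ : (Fin d → ℤ) → ℝ) (B : ℝ),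
      (∀ j, hat h j s ≠ 0 → |φ j| ≤ B) →
      |∑ j ∈ box d h δ, hat h j s * (φ j * oneNorm (meshPt h j))| ≤ B * oneNorm s := by
    intro φ B hφ
    rw [← hN, Finset.mul_sum]
    refine (Finset.abs_sum_le_sum_abs _ _).trans (Finset.sum_le_sum fun j _ => ?_)
    by_cases hj : hat h j s = 0
    · simp [hj]
    · rw [abs_mul, abs_mul, abs_of_nonneg (hat_nonneg h j s), abs_of_nonneg (oneNorm_nonneg _)]
      have := mul_le_mul_of_nonneg_right (hφ j hj)
        (mul_nonneg (hat_nonneg h j s) (oneNorm_nonneg (meshPt h j)))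
      linarith
  -- Near the origin no cancellation is needed: |p| ≤ 2M|·|² and the active nodes lie within 3dh, so
  -- each term separately has the right size. Farther out, |s_j - s| ≤ |s|/2 and the Taylor estimate
  -- applies.
  rcases lt_or_ge ‖s‖ (2 * (d * h)) with hcase | hcase
  · have t1 : |∑ j ∈ box d h δ, hat h j s * (p (meshPt h j) * oneNorm (meshPt h j))|
        ≤ 18 * d ^ 2 * M * h ^ 2 * oneNorm s := by
      refine weighted (fun j => p (meshPt h j)) _ fun j hj => (hpb _).trans ?_
      have h3 : ‖meshPt h j‖ ≤ 3 * (d * h) := by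
        have := norm_le_norm_add_norm_sub' (meshPt h j) s
        linarith [hη2 j hj]
      calc 2 * M * ‖meshPt h j‖ ^ 2 ≤ 2 * M * (3 * (d * h)) ^ 2 := by gcongr
        _ = _ := by ring
    have t2 : |p s * oneNorm s| ≤ 8 * d ^ 2 * M * h ^ 2 * oneNorm s := by
      rw [abs_mul, abs_of_nonneg hs1]
      refine mul_le_mul_of_nonneg_right ((hpb s).trans ?_) hs1
      calc 2 * M * ‖s‖ ^ 2 ≤ 2 * M * (2 * (d * h)) ^ 2 := by gcongr
        _ = _ := by ring
    have t3 : 0 ≤ (d : ℝ) ^ 2 * M * h ^ 2 * oneNorm s := by positivity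
    exact (abs_sub _ _).trans (by linarith)
  -- In this branch the origin can occur only when d = 0, which is not excluded here.
  · rcases eq_or_ne s 0 with rfl | hs0
    · have t1 := weighted (fun j => p (meshPt h j)) (2 * M * (d * h) ^ 2) fun j hj =>
        (hpb _).trans (by
          have := hη2 j hj
          rw [sub_zero] at this
          gcongr)
      simpa [oneNorm_zero] using t1
    obtain ⟨ℓ, hℓ, hT⟩ := quotient_taylor hM h0 h1 b0 b1 b2 hs0
    -- The three reproduction identities permit subtracting the affine model of p. What is left is
    -- its Taylor error (constant 92) and a product of two increments, each of first order in h
    -- (constant 6).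
    have split : ∑ j ∈ box d h δ, hat h j s * (p (meshPt h j) * oneNorm (meshPt h j))
          - p s * oneNorm s
        = ∑ j ∈ box d h δ, hat h j s *
            ((p (meshPt h j) - p s - ℓ (meshPt h j - s)) * oneNorm (meshPt h j))
          + ∑ j ∈ box d h δ, hat h j s *
            (ℓ (meshPt h j - s) * (oneNorm (meshPt h j) - oneNorm s)) := by
      have e1 : ∑ j ∈ box d h δ, hat h j s * ℓ (meshPt h j - s) = 0 := by
        have : ∑ j ∈ box d h δ, hat h j s * ℓ (meshPt h j - s)
            = ℓ (∑ j ∈ box d h δ, hat h j s • meshPt h j)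
              - (∑ j ∈ box d h δ, hat h j s) * ℓ s := by
          simp only [map_sum, map_smul, map_sub, smul_eq_mul, mul_sub, Finset.sum_sub_distrib,
            Finset.sum_mul]
        rw [this, sum_hat_smul_meshPt hh hs, sum_hat hh hs]
        ring
      have e2 : p s * oneNorm s
          = ∑ j ∈ box d h δ, hat h j s * (p s * oneNorm (meshPt h j)) := by
        rw [← hN, Finset.mul_sum]
        exact Finset.sum_congr rfl fun j _ => by ring
      have e3 : ∑ j ∈ box d h δ, hat h j s * ℓ (meshPt h j - s) * oneNorm s = 0 := by
        rw [← Finset.sum_mul, e1, zero_mul]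
      rw [e2, ← Finset.sum_sub_distrib, ← Finset.sum_add_distrib, ← sub_eq_zero,
        ← Finset.sum_sub_distrib, ← e3]
      exact Finset.sum_congr rfl fun j _ => by ring
    have t1 := weighted (fun j => p (meshPt h j) - p s - ℓ (meshPt h j - s))
      (92 * M * (d * h) ^ 2) fun j hj => by
        have h5 := hT (meshPt h j - s) ((hη2 j hj).trans (by linarith))
        rw [add_sub_cancel] at h5
        refine h5.trans ?_
        have := hη2 j hj
        gcongr
    have t2 : |∑ j ∈ box d h δ, hat h j s *
        (ℓ (meshPt h j - s) * (oneNorm (meshPt h j) - oneNorm s))|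
          ≤ 6 * M * oneNorm s * (d * h) * (d * h) := by
      calc _ ≤ ∑ j ∈ box d h δ, hat h j s * (6 * M * oneNorm s * (d * h) * (d * h)) := by
            refine (Finset.abs_sum_le_sum_abs _ _).trans (Finset.sum_le_sum fun j _ => ?_)
            by_cases hj : hat h j s = 0
            · simp [hj]
            rw [abs_mul, abs_of_nonneg (hat_nonneg h j s), abs_mul]
            refine mul_le_mul_of_nonneg_left ?_ (hat_nonneg h j s)
            refine mul_le_mul ((hℓ _).trans ?_) ((oneNorm_sub_le _ _).trans (hη1 j hj))
              (abs_nonneg _) (by positivity)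
            have := hη2 j hj
            have := norm_le_oneNorm s
            gcongr
        _ = _ := by rw [← Finset.sum_mul, sum_hat hh hs, one_mul]
    rw [split]
    refine (abs_add_le _ _).trans ((add_le_add t1 t2).trans (le_of_eq ?_))
    ring

end Interpolation

/-! ### Signed permutations of the coordinates -/

section Symmetry

variable {d : ℕ}

/-- The action of a signed permutation on the lattice. -/
def latticeMap (σ : Fin d → ℤ) (π : Fin d → Fin d) (j : Fin d → ℤ) : Fin d → ℤ :=
  fun k => σ k * j (π k)

/-- An involutive signed permutation of the coordinates. -/
structure IsSignedInvolution (σ : Fin d → ℤ) (π : Fin d → Fin d) : Prop where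
  sign : ∀ k, |σ k| = 1
  invol : Function.Involutive π
  compat : ∀ k, σ (π k) = σ k

namespace IsSignedInvolution

variable {σ : Fin d → ℤ} {π : Fin d → Fin d} (H : IsSignedInvolution σ π)

include H

theorem mul_self (k : Fin d) : σ k * σ k = 1 := by
  rw [← abs_mul_abs_self, H.sign k, one_mul]

theorem abs_cast (k : Fin d) : |(σ k : ℝ)| = 1 := by exact_mod_cast H.sign k

theorem sum_comp (f : Fin d → ℝ) : ∑ k, f (π k) = ∑ k, f k :=
  Equiv.sum_comp H.invol.toPerm f

theorem prod_comp (f : Fin d → ℝ) : ∏ k, f (π k) = ∏ k, f k :=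
  Equiv.prod_comp H.invol.toPerm f

/-- Sign compatibility makes the map its own inverse, so stencil sums can be reindexed without a
separate inverse. -/
theorem latticeMap_involutive : Function.Involutive (latticeMap σ π) := by
  intro j
  funext k
  simp only [latticeMap]
  rw [H.compat, H.invol k, ← mul_assoc, H.mul_self, one_mul]

/-- The isometry of `ℝ^d` given by a signed permutation. -/
noncomputable def isometry : Sp d ≃ₗᵢ[ℝ] Sp d where
  toLinearEquiv := LinearEquiv.ofInvolutive
    { toFun := fun s => WithLp.toLp 2 fun k => (σ k : ℝ) * s (π k)
      map_add' := fun s y => by ext k; simp [mul_add]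
      map_smul' := fun c s => by ext k; simp; ring }
    (fun s => by
      ext k
      have : (σ k : ℝ) * σ k = 1 := by exact_mod_cast H.mul_self k
      simp [H.compat, H.invol k, ← mul_assoc, this])
  norm_map' s := by
    simp only [EuclideanSpace.norm_eq]
    congr 1
    rw [← H.sum_comp fun k => ‖s k‖ ^ 2]
    refine Finset.sum_congr rfl fun k _ => ?_
    change ‖(σ k : ℝ) * s (π k)‖ ^ 2 = _
    rw [norm_mul, Real.norm_eq_abs (σ k : ℝ), H.abs_cast, one_mul]

theorem isometry_apply (s : Sp d) (k : Fin d) : H.isometry s k = σ k * s (π k) := rfl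

theorem meshPt_latticeMap (h : ℝ) (j : Fin d → ℤ) :
    meshPt h (latticeMap σ π j) = H.isometry (meshPt h j) := by
  ext k
  rw [H.isometry_apply, meshPt_apply, meshPt_apply, latticeMap]
  push_cast
  ring

theorem oneNorm_isometry (s : Sp d) : oneNorm (H.isometry s) = oneNorm s := by
  unfold oneNorm
  rw [← H.sum_comp fun k => |s k|]
  refine Finset.sum_congr rfl fun k _ => ?_
  rw [H.isometry_apply, abs_mul, H.abs_cast, one_mul]

theorem hat_latticeMap (h : ℝ) (j : Fin d → ℤ) (s : Sp d) :
    hat h (latticeMap σ π j) (H.isometry s) = hat h j s := by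
  unfold hat
  rw [← H.prod_comp fun k => max 0 (1 - |s k / h - j k|)]
  refine Finset.prod_congr rfl fun k _ => ?_
  have : H.isometry s k / h - (latticeMap σ π j k : ℤ) = σ k * (s (π k) / h - j (π k)) := by
    rw [H.isometry_apply, latticeMap]
    push_cast
    ring
  rw [this, abs_mul, H.abs_cast, one_mul]

theorem setIntegral_ball_comp (δ : ℝ) (f : Sp d → ℝ) :
    ∫ s in Metric.ball (0 : Sp d) δ, f (H.isometry s) = ∫ s in Metric.ball (0 : Sp d) δ, f s := by
  have h1 := H.isometry.measurePreserving.setIntegral_preimage_emb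
    H.isometry.toHomeomorph.measurableEmbedding f (Metric.ball 0 δ)
  have h2 : H.isometry ⁻¹' Metric.ball (0 : Sp d) δ = Metric.ball 0 δ := by
    ext s
    simp
  rwa [h2] at h1

theorem beta_latticeMap (h δ : ℝ) (ρ : ℝ → ℝ) (j : Fin d → ℤ) :
    beta h δ ρ (latticeMap σ π j) = beta h δ ρ j := by
  unfold beta
  rw [← H.setIntegral_ball_comp]
  simp only [H.hat_latticeMap, H.oneNorm_isometry, LinearIsometryEquiv.norm_map]

theorem coeff_latticeMap (h δ : ℝ) (ρ : ℝ → ℝ) (j : Fin d → ℤ) :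
    coeff h δ ρ (latticeMap σ π j) = coeff h δ ρ j := by
  unfold coeff
  rw [H.beta_latticeMap, H.meshPt_latticeMap, H.oneNorm_isometry, LinearIsometryEquiv.norm_map]

theorem latticeMap_mem_stencil {h δ : ℝ} {j : Fin d → ℤ} (hj : j ∈ stencil d h δ) :
    latticeMap σ π j ∈ stencil d h δ := by
  simp only [stencil, Finset.mem_erase, Fintype.mem_piFinset, Finset.mem_Icc, ← abs_le] at hj ⊢
  refine ⟨fun h0 => hj.1 ?_, fun k => ?_⟩
  · rw [← H.latticeMap_involutive j, h0]
    funext k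
    simp [latticeMap]
  · rw [latticeMap, abs_mul, H.sign, one_mul]
    exact hj.2 (π k)

theorem sum_stencil_comp (h δ : ℝ) (f : (Fin d → ℤ) → ℝ) :
    ∑ j ∈ stencil d h δ, f (latticeMap σ π j) = ∑ j ∈ stencil d h δ, f j :=
  Finset.sum_nbij' (latticeMap σ π) (latticeMap σ π) (fun _ => H.latticeMap_mem_stencil)
    (fun _ => H.latticeMap_mem_stencil) (fun j _ => H.latticeMap_involutive j)
    (fun j _ => H.latticeMap_involutive j) fun _ _ => rfl

end IsSignedInvolution

theorem isSignedInvolution_reflection (k : Fin d) :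
    IsSignedInvolution (fun l => if l = k then -1 else 1) id where
  sign l := by split_ifs <;> simp
  invol _ := rfl
  compat _ := rfl

theorem isSignedInvolution_swap (k l : Fin d) :
    IsSignedInvolution (fun _ => 1) (Equiv.swap k l) where
  sign _ := by simp
  invol _ := Equiv.swap_apply_self _ _ _
  compat _ := rfl

/-- A form that is invariant under signed permutations is a multiple of the identity. -/
theorem eq_ite_of_signed_invariant (hd : 0 < d) {A : Fin d → Fin d → ℝ}
    (hA : ∀ σ π, IsSignedInvolution σ π → ∀ k l, A k l = σ k * σ l * A (π k) (π l))
    (htr : ∑ k, A k k = d) (k l : Fin d) : A k l = if k = l then 1 else 0 := by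
  split_ifs with hkl
  · subst hkl
    have h1 : ∀ l, A l l = A k k := fun l => by
      simpa using hA _ _ (isSignedInvolution_swap l k) l l
    simp only [h1, Finset.sum_const, Finset.card_univ, Fintype.card_fin, nsmul_eq_mul] at htr
    have : (d : ℝ) ≠ 0 := by positivity
    field_simp at htr
    exact htr
  -- Reflecting one coordinate changes the sign of an off-diagonal entry; the swaps above made the
  -- diagonal constant.
  · have h1 := hA _ _ (isSignedInvolution_reflection k) k l
    simp [Ne.symm hkl] at h1
    linarith

end Symmetry

/-! ### Consistency of the discrete operator -/

section Consistency

set_option maxSynthPendingDepth 3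

variable {d : ℕ} {h δ : ℝ} {ρ : ℝ → ℝ}

theorem ae_ball_of_forall {P : Sp d → Prop} (hP : ∀ s : Sp d, ‖s‖ < δ → P s) :
    ∀ᵐ s ∂(volume.restrict (Metric.ball (0 : Sp d) δ)), P s :=
  (ae_restrict_iff' Metric.isOpen_ball.measurableSet).2
    (Filter.Eventually.of_forall fun s hs => hP s (mem_ball_zero_iff.1 hs))

namespace IsKernel

variable (H : IsKernel d δ ρ)

include H

theorem weight_nonneg {s : Sp d} (hs : ‖s‖ < δ) : 0 ≤ ‖s‖ ^ 2 * ρ ‖s‖ :=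
  mul_nonneg (by positivity) (H.nonneg _ ⟨norm_nonneg s, hs.le⟩)

theorem integrableOn_mul {φ : Sp d → ℝ} (hφ : Measurable φ) {c : ℝ}
    (hb : ∀ s, ‖s‖ < δ → |φ s| ≤ c) :
    IntegrableOn (fun s => ‖s‖ ^ 2 * ρ ‖s‖ * φ s) (Metric.ball 0 δ) :=
  H.integrable.mul_bdd (c := c) hφ.aestronglyMeasurable (ae_ball_of_forall hb)

/-- Uniformity in δ and ρ enters here: the kernel is seen only through its normalized moment. -/
theorem abs_setIntegral_mul_le {φ : Sp d → ℝ} {c : ℝ} (hb : ∀ s, ‖s‖ < δ → |φ s| ≤ c) :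
    |∫ s in Metric.ball (0 : Sp d) δ, ‖s‖ ^ 2 * ρ ‖s‖ * φ s| ≤ 2 * d * c := by
  rw [← H.moment, ← integral_mul_const, ← Real.norm_eq_abs]
  refine norm_integral_le_of_norm_le (H.integrable.mul_const c) (ae_ball_of_forall fun s hs => ?_)
  rw [Real.norm_eq_abs, abs_mul, abs_of_nonneg (H.weight_nonneg hs)]
  exact mul_le_mul_of_nonneg_left (hb s hs) (H.weight_nonneg hs)

theorem beta_nonneg (h : ℝ) (j : Fin d → ℤ) : 0 ≤ beta h δ ρ j := by
  refine mul_nonneg (by norm_num) (setIntegral_nonneg Metric.isOpen_ball.measurableSet fun s hs => ?_)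
  have hs' := mem_ball_zero_iff.1 hs
  exact mul_nonneg (mul_nonneg (hat_nonneg h j s) (div_nonneg (by positivity) (oneNorm_nonneg s)))
    (H.nonneg _ ⟨norm_nonneg s, hs'.le⟩)

theorem coeff_nonneg (h : ℝ) (j : Fin d → ℤ) : 0 ≤ coeff h δ ρ j :=
  mul_nonneg (div_nonneg (oneNorm_nonneg _) (by positivity)) (H.beta_nonneg h j)

/-- The quadrature as the integral of an interpolant. -/
theorem sum_beta_mul (hh : 0 < h) (φ : (Fin d → ℤ) → ℝ) :
    ∑ j ∈ stencil d h δ, beta h δ ρ j * φ j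
      = (1 / 2) * ∫ s in Metric.ball (0 : Sp d) δ,
          ‖s‖ ^ 2 * ρ ‖s‖ * ((∑ j ∈ stencil d h δ, hat h j s * φ j) / oneNorm s) := by
  have h1 : ∀ j ∈ stencil d h δ, beta h δ ρ j * φ j
      = (1 / 2) * ∫ s in Metric.ball (0 : Sp d) δ,
        ‖s‖ ^ 2 * ρ ‖s‖ * (hat h j s / oneNorm s) * φ j := by
    intro j _
    rw [integral_mul_const, ← mul_assoc, beta]
    congr 3
    funext s
    ring
  rw [Finset.sum_congr rfl h1, ← Finset.mul_sum, ← integral_finsetSum]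
  · congr 2
    funext s
    rw [Finset.sum_div, Finset.mul_sum]
    exact Finset.sum_congr rfl fun j _ => by ring
  · intro j hj
    refine (H.integrableOn_mul (c := h⁻¹)
      ((continuous_hat h j).measurable.div continuous_oneNorm.measurable) fun s _ => ?_).mul_const _
    change |hat h j s / oneNorm s| ≤ _
    rw [abs_of_nonneg (div_nonneg (hat_nonneg h j s) (oneNorm_nonneg s))]
    exact hat_div_oneNorm_le hh (Finset.ne_of_mem_erase hj) s

/-- The kernel alone may fail to be integrable at the origin, so integrability must be paid for by a
factor |s|². -/
theorem integrableOn_mul_of_le_sq {f : Sp d → ℝ} (hf : Measurable f) {c : ℝ}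
    (hb : ∀ s, ‖s‖ < δ → |f s| ≤ c * ‖s‖ ^ 2) :
    IntegrableOn (fun s => ρ ‖s‖ * f s) (Metric.ball 0 δ) := by
  have h1 : (fun s : Sp d => ρ ‖s‖ * f s) =ᵐ[volume.restrict (Metric.ball 0 δ)]
      fun s => ‖s‖ ^ 2 * ρ ‖s‖ * (f s / ‖s‖ ^ 2) := ae_ball_of_forall fun s hs => by
    rcases eq_or_ne s 0 with rfl | h0
    · have := hb 0 hs
      simp at this
      simp [this]
    · have := norm_ne_zero_iff.2 h0
      field_simp
  refine (H.integrableOn_mul (c := |c|) (hf.div (measurable_norm.pow_const 2)) fun s hs => ?_).congr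
    h1.symm
  change |f s / ‖s‖ ^ 2| ≤ _
  rw [abs_div, abs_of_nonneg (by positivity : 0 ≤ ‖s‖ ^ 2)]
  exact div_le_of_le_mul₀ (by positivity) (abs_nonneg _)
    ((hb s hs).trans (mul_le_mul_of_nonneg_right (le_abs_self c) (by positivity)))

theorem integrableOn_mul_apply (k l : Fin d) :
    IntegrableOn (fun s : Sp d => ρ ‖s‖ * (s k * s l)) (Metric.ball 0 δ) :=
  H.integrableOn_mul_of_le_sq (c := 1) (by fun_prop) fun s _ => by
    rw [abs_mul, one_mul, sq]
    exact mul_le_mul (abs_apply_le_norm s k) (abs_apply_le_norm s l) (abs_nonneg _) (norm_nonneg _)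

/-- Second moments of the kernel. -/
theorem second_moment (hd : 0 < d) (k l : Fin d) :
    (1 / 2) * ∫ s in Metric.ball (0 : Sp d) δ, ρ ‖s‖ * (s k * s l) = if k = l then 1 else 0 := by
  refine eq_ite_of_signed_invariant hd
    (A := fun k l => (1 / 2) * ∫ s in Metric.ball (0 : Sp d) δ, ρ ‖s‖ * (s k * s l))
    (fun σ π hσ k l => ?_) ?_ k l
  · simp only
    rw [← hσ.setIntegral_ball_comp, mul_left_comm, ← integral_const_mul (σ k * σ l : ℝ)]
    congr 2
    funext s
    rw [hσ.isometry_apply, hσ.isometry_apply, LinearIsometryEquiv.norm_map]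
    ring
  · rw [← Finset.mul_sum, ← integral_finsetSum _ fun k _ => H.integrableOn_mul_apply k k]
    have h1 : ∀ s : Sp d, ∑ k, ρ ‖s‖ * (s k * s k) = ‖s‖ ^ 2 * ρ ‖s‖ := fun s => by
      rw [← Finset.mul_sum, EuclideanSpace.norm_sq_eq, mul_comm]
      congr 1
      exact Finset.sum_congr rfl fun k _ => by rw [Real.norm_eq_abs, sq_abs, sq]
    simp only [h1]
    rw [H.moment]
    ring

/-- The discrete operator has the second moments of the kernel. -/
theorem discrete_second_moment (hd : 0 < d) (hh : 0 < h) (k l : Fin d) :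
    ∑ j ∈ stencil d h δ, coeff h δ ρ j * (meshPt h j k * meshPt h j l)
      = if k = l then 1 else 0 := by
  refine eq_ite_of_signed_invariant hd
    (A := fun k l => ∑ j ∈ stencil d h δ, coeff h δ ρ j * (meshPt h j k * meshPt h j l))
    (fun σ π hσ k l => ?_) ?_ k l
  · simp only
    rw [← hσ.sum_stencil_comp, Finset.mul_sum]
    refine Finset.sum_congr rfl fun j _ => ?_
    rw [hσ.coeff_latticeMap, hσ.meshPt_latticeMap, hσ.isometry_apply, hσ.isometry_apply]
    ring
  -- For the trace, |s_j|² cancels the denominator of the coefficient, leaving the quadrature of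
  -- ‖·‖₁; exact interpolation reduces it to half the moment 2d.
  · rw [Finset.sum_comm]
    have h1 : ∀ j ∈ stencil d h δ, ∑ k, coeff h δ ρ j * (meshPt h j k * meshPt h j k)
        = beta h δ ρ j * oneNorm (meshPt h j) := fun j _ => by
      have h2 : ∑ k, meshPt h j k * meshPt h j k = ‖meshPt h j‖ ^ 2 := by
        rw [EuclideanSpace.norm_sq_eq]
        exact Finset.sum_congr rfl fun k _ => by rw [Real.norm_eq_abs, sq_abs, sq]
      rw [← Finset.mul_sum, h2, coeff]
      rcases eq_or_ne (meshPt h j) 0 with h0 | h0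
      · simp [h0, oneNorm_zero]
      · have := norm_ne_zero_iff.2 h0
        field_simp
    rw [Finset.sum_congr rfl h1, H.sum_beta_mul hh]
    have h3 : ∫ s in Metric.ball (0 : Sp d) δ, ‖s‖ ^ 2 * ρ ‖s‖ *
        ((∑ j ∈ stencil d h δ, hat h j s * oneNorm (meshPt h j)) / oneNorm s)
        = ∫ s in Metric.ball (0 : Sp d) δ, ‖s‖ ^ 2 * ρ ‖s‖ := by
      refine integral_congr_ae (ae_ball_of_forall fun s hs => ?_)
      simp only
      rw [sum_stencil_eq_sum_box (by simp [meshPt_zero, oneNorm_zero]),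
        sum_hat_mul_oneNorm hh hs]
      rcases eq_or_ne s 0 with rfl | h0
      · simp
      · rw [div_self (oneNorm_pos h0).ne', mul_one]
    rw [h3, H.moment]
    ring

end IsKernel

theorem bilin_apply_eq_sum (B : Sp d →L[ℝ] Sp d →L[ℝ] ℝ) (s : Sp d) :
    B s s = ∑ k, ∑ l, s k * s l *
      B (EuclideanSpace.single k 1) (EuclideanSpace.single l 1) := by
  have h1 : s = ∑ k, s k • EuclideanSpace.single k (1 : ℝ) := by
    ext l
    simp [Finset.sum_apply, Pi.single_apply]
  conv_lhs => rw [h1]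
  simp only [map_sum, map_smul, sum_apply, smul_apply,
    smul_eq_mul, Finset.mul_sum]
  rw [Finset.sum_comm]
  exact Finset.sum_congr rfl fun k _ => Finset.sum_congr rfl fun l _ => by ring

namespace IsKernel

variable (H : IsKernel d δ ρ)

include H

/-- The quadrature is exact for quadratic forms. -/
theorem quadrature_exact (hd : 0 < d) (hh : 0 < h) (B : Sp d →L[ℝ] Sp d →L[ℝ] ℝ) :
    ∑ j ∈ stencil d h δ, coeff h δ ρ j * B (meshPt h j) (meshPt h j)
      = (1 / 2) * ∫ s in Metric.ball (0 : Sp d) δ, ρ ‖s‖ * B s s := by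
  set b := fun k l : Fin d =>
    B (EuclideanSpace.single k 1) (EuclideanSpace.single l 1) with hb
  have h1 : ∑ j ∈ stencil d h δ, coeff h δ ρ j * B (meshPt h j) (meshPt h j)
      = ∑ k, ∑ l, (if k = l then 1 else 0) * b k l := by
    simp only [bilin_apply_eq_sum B, Finset.mul_sum]
    rw [Finset.sum_comm]
    refine Finset.sum_congr rfl fun k _ => ?_
    rw [Finset.sum_comm]
    refine Finset.sum_congr rfl fun l _ => ?_
    rw [← H.discrete_second_moment hd hh k l, Finset.sum_mul]
    exact Finset.sum_congr rfl fun j _ => by ring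
  have h2 : ∀ s : Sp d, ρ ‖s‖ * B s s = ∑ k, ∑ l, ρ ‖s‖ * (s k * s l) * b k l := fun s => by
    simp only [bilin_apply_eq_sum B s, Finset.mul_sum]
    exact Finset.sum_congr rfl fun k _ => Finset.sum_congr rfl fun l _ => by ring
  rw [h1]
  simp only [h2]
  rw [integral_finsetSum _ fun k _ => integrable_finsetSum _ fun l _ =>
    (H.integrableOn_mul_apply k l).mul_const _, Finset.mul_sum]
  refine Finset.sum_congr rfl fun k _ => ?_
  rw [integral_finsetSum _ fun l _ => (H.integrableOn_mul_apply k l).mul_const _,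
    Finset.mul_sum]
  refine Finset.sum_congr rfl fun l _ => ?_
  rw [integral_mul_const, ← mul_assoc, H.second_moment hd]

/-- The quadrature error for functions that vanish to fourth order at the origin. -/
theorem quadrature_error_le (hh : 0 < h) {E : Sp d → ℝ} {E₁ : Sp d → Sp d →L[ℝ] ℝ}
    {E₂ : Sp d → Sp d →L[ℝ] Sp d →L[ℝ] ℝ} {M : ℝ}
    (hM : 0 ≤ M) (h0 : ∀ z, HasFDerivAt E (E₁ z) z) (h1 : ∀ z, HasFDerivAt E₁ (E₂ z) z)
    (b0 : ∀ z, ‖E z‖ ≤ 2 * M * ‖z‖ ^ 4) (b1 : ∀ z, ‖E₁ z‖ ≤ 2 * M * ‖z‖ ^ 3)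
    (b2 : ∀ z, ‖E₂ z‖ ≤ 2 * M * ‖z‖ ^ 2) :
    |∑ j ∈ stencil d h δ, coeff h δ ρ j * E (meshPt h j)
        - (1 / 2) * ∫ s in Metric.ball (0 : Sp d) δ, ρ ‖s‖ * E s| ≤ 98 * d ^ 3 * M * h ^ 2 := by
  have e0 : E 0 = 0 := by simpa using b0 0
  have hmeas : Measurable E :=
    (continuous_iff_continuousAt.2 fun z => (h0 z).continuousAt).measurable
  set W : (Fin d → ℤ) → ℝ := fun j => E (meshPt h j) / ‖meshPt h j‖ ^ 2 * oneNorm (meshPt h j)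
    with hW
  have s1 : ∑ j ∈ stencil d h δ, coeff h δ ρ j * E (meshPt h j)
      = ∑ j ∈ stencil d h δ, beta h δ ρ j * W j :=
    Finset.sum_congr rfl fun j _ => by rw [coeff, hW]; ring
  have s2 : ∀ s : Sp d, ρ ‖s‖ * E s = ‖s‖ ^ 2 * ρ ‖s‖ * (E s / ‖s‖ ^ 2) := fun s => by
    rcases eq_or_ne s 0 with rfl | hs
    · simp [e0]
    · have := norm_ne_zero_iff.2 hs
      field_simp
  have hEb : ∀ s : Sp d, ‖s‖ < δ → |E s / ‖s‖ ^ 2| ≤ 2 * M * δ ^ 2 := fun s hs => by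
    rw [abs_div, abs_of_nonneg (by positivity : 0 ≤ ‖s‖ ^ 2)]
    refine div_le_of_le_mul₀ (by positivity) (by positivity) ((b0 s).trans ?_)
    calc 2 * M * ‖s‖ ^ 4 = 2 * M * ‖s‖ ^ 2 * ‖s‖ ^ 2 := by ring
      _ ≤ _ := by gcongr
  -- Dividing the interpolation error by ‖s‖₁ leaves a bound uniform in s; its integral supplies the
  -- third factor d.
  have hB : ∀ s : Sp d, ‖s‖ < δ →
      |(∑ j ∈ stencil d h δ, hat h j s * W j) / oneNorm s - E s / ‖s‖ ^ 2|
        ≤ 98 * d ^ 2 * M * h ^ 2 := fun s hs => by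
    rcases eq_or_ne s 0 with rfl | hs0
    · simp only [oneNorm_zero, norm_zero, e0, div_zero, zero_div, sub_zero, abs_zero]
      positivity
    · have hp := oneNorm_pos hs0
      have h3 := interpolation_error_le hh hM h0 h1 b0 b1 b2 hs
      rw [sum_stencil_eq_sum_box (by simp [hW, meshPt_zero, oneNorm_zero]),
        ← mul_le_mul_iff_left₀ hp]
      refine le_trans (le_of_eq ?_) h3
      conv_lhs => rw [← abs_of_pos hp, ← abs_mul, sub_mul, abs_of_pos hp,
        div_mul_cancel₀ _ hp.ne']
  have i1 : IntegrableOn (fun s : Sp d => ‖s‖ ^ 2 * ρ ‖s‖ *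
      ((∑ j ∈ stencil d h δ, hat h j s * W j) / oneNorm s)) (Metric.ball 0 δ) := by
    refine H.integrableOn_mul (c := 98 * d ^ 2 * M * h ^ 2 + 2 * M * δ ^ 2) ?_ fun s hs => ?_
    · exact (Finset.measurable_fun_sum _ fun j _ =>
        (continuous_hat h j).measurable.mul_const _).div continuous_oneNorm.measurable
    · have := abs_sub_abs_le_abs_sub
        ((∑ j ∈ stencil d h δ, hat h j s * W j) / oneNorm s) (E s / ‖s‖ ^ 2)
      linarith [hB s hs, hEb s hs]
  have i2 : IntegrableOn (fun s : Sp d => ‖s‖ ^ 2 * ρ ‖s‖ * (E s / ‖s‖ ^ 2)) (Metric.ball 0 δ) :=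
    H.integrableOn_mul (hmeas.div (measurable_norm.pow_const 2)) hEb
  rw [s1, H.sum_beta_mul hh]
  simp only [s2]
  rw [← mul_sub, ← integral_sub i1 i2, abs_mul, abs_of_pos (by norm_num : (0 : ℝ) < 1 / 2)]
  simp only [← mul_sub]
  calc _ ≤ 1 / 2 * (2 * d * (98 * d ^ 2 * M * h ^ 2)) :=
        mul_le_mul_of_nonneg_left (H.abs_setIntegral_mul_le hB) (by norm_num)
    _ = _ := by ring

/-- The difference operator approximates the nonlocal operator to second order, uniformly in
the kernel. -/
theorem consistency (hd : 0 < d) (hh : 0 < h) {v : Sp d → ℝ} (hv : ContDiff ℝ 4 v) {M : ℝ}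
    (hM : ∀ x, ‖iteratedFDeriv ℝ 4 v x‖ ≤ M) (x : Sp d) :
    |∑ j ∈ stencil d h δ, coeff h δ ρ j * (v (x + meshPt h j) + v (x - meshPt h j) - 2 * v x)
        - nonlocalOp δ ρ v x| ≤ 98 * d ^ 3 * M * h ^ 2 := by
  have hM0 : 0 ≤ M := (norm_nonneg _).trans (hM x)
  obtain ⟨E₁, E₂, h0, h1, b0, b1, b2⟩ := secondDiffRem_expansion hv hM x
  set B := fderiv ℝ (fderiv ℝ v) x with hB
  have hsplit : ∀ s, v (x + s) + v (x - s) - 2 * v x = secondDiffRem v x s + B s s := fun s => by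
    simp [secondDiffRem, hB]
  have hmeas : Measurable (secondDiffRem v x) :=
    (continuous_iff_continuousAt.2 fun z => (h0 z).continuousAt).measurable
  have i1 : IntegrableOn (fun s : Sp d => ρ ‖s‖ * secondDiffRem v x s) (Metric.ball 0 δ) :=
    H.integrableOn_mul_of_le_sq (c := 2 * M * δ ^ 2) hmeas fun s hs => (b0 s).trans (by
      calc 2 * M * ‖s‖ ^ 4 = 2 * M * ‖s‖ ^ 2 * ‖s‖ ^ 2 := by ring
        _ ≤ _ := by gcongr)
  have i2 : IntegrableOn (fun s : Sp d => ρ ‖s‖ * B s s) (Metric.ball 0 δ) :=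
    H.integrableOn_mul_of_le_sq (c := ‖B‖) (by
      exact (B.continuous.clm_apply continuous_id).measurable) fun s _ =>
        (B.le_opNorm₂ s s).trans (le_of_eq (by ring))
  have h3 := H.quadrature_error_le hh hM0 h0 h1 b0 b1 b2
  have h4 := H.quadrature_exact hd hh B
  unfold nonlocalOp
  simp only [hsplit, mul_add, Finset.sum_add_distrib]
  -- The quadratic parts cancel exactly; only the fourth-order remainder is left.
  rw [integral_add i1 i2, h4, mul_add, add_sub_add_right_eq_sub]
  exact h3

end IsKernel

end Consistency

/-! ### The discrete semigroup and the maximum bound principle -/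

section MaximumPrinciple

open scoped Matrix
open NormedSpace (exp)

variable {d : ℕ} {δ κ ε : ℝ} {ρ : ℝ → ℝ}

/-- All coefficients are nonnegative, so `Lh` is (c+κ)I - P with P entrywise nonnegative and all row
sums equal to c. Shifts that wrap around onto the diagonal do no harm, since P need not have zero
diagonal. -/
theorem IsKernel.norm_exp_Lh_mulVec_le (H : IsKernel d δ ρ) (h : ℝ) (N : ℕ) [NeZero N] {t : ℝ}
    (ht : 0 ≤ t) (v : Grid d N → ℝ) :
    ‖exp (t • (-Lh ε κ h δ ρ N)) *ᵥ v‖ ≤ Real.exp (-(κ * t)) * ‖v‖ := by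
  have hc : 0 ≤ ∑ j ∈ stencil d h δ, coeff h δ ρ j :=
    Finset.sum_nonneg fun j _ => H.coeff_nonneg h j
  let P : Matrix (Grid d N) (Grid d N) ℝ := fun i i' => ε ^ 2 * ∑ j ∈ stencil d h δ,
    coeff h δ ρ j * ((if i' = i + (fun k => (j k : ZMod N)) then 1 else 0)
      + (if i' = i - (fun k => (j k : ZMod N)) then 1 else 0))
  have hP0 : ∀ i i', 0 ≤ P i i' := fun i i' =>
    mul_nonneg (sq_nonneg ε) (Finset.sum_nonneg fun j _ => mul_nonneg (H.coeff_nonneg h j)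
      (add_nonneg (by split_ifs <;> norm_num) (by split_ifs <;> norm_num)))
  refine norm_exp_mulVec_le (P := P) (c := ε ^ 2 * (2 * ∑ j ∈ stencil d h δ, coeff h δ ρ j))
    (by positivity) (fun i => ?_) ?_ ht v
  · simp only [abs_of_nonneg (hP0 i _)]
    simp only [P, ← Finset.mul_sum]
    rw [Finset.sum_comm]
    simp only [← Finset.mul_sum, Finset.sum_add_distrib, Finset.sum_ite_eq', Finset.mem_univ,
      if_true]
    rw [← Finset.sum_mul]
    exact le_of_eq (by ring)
  · ext i i'
    have h1 : ∀ e : ℝ, ∑ j ∈ stencil d h δ, coeff h δ ρ j *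
          ((if i' = i + (fun k => (j k : ZMod N)) then 1 else 0)
            + (if i' = i - (fun k => (j k : ZMod N)) then 1 else 0) - 2 * e)
        = ∑ j ∈ stencil d h δ, coeff h δ ρ j *
          ((if i' = i + (fun k => (j k : ZMod N)) then 1 else 0)
            + (if i' = i - (fun k => (j k : ZMod N)) then 1 else 0))
          - (∑ j ∈ stencil d h δ, coeff h δ ρ j) * (2 * e) := fun e => by
      rw [Finset.sum_mul, ← Finset.sum_sub_distrib]
      exact Finset.sum_congr rfl fun j _ => by ring
    change -(ε ^ 2) * stiffness h δ ρ N i i' + κ * (1 : Matrix (Grid d N) (Grid d N) ℝ) i i'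
      = (ε ^ 2 * (2 * ∑ j ∈ stencil d h δ, coeff h δ ρ j) + κ)
        * (1 : Matrix (Grid d N) (Grid d N) ℝ) i i' - P i i'
    rw [Matrix.one_apply, stiffness, h1]
    simp only [P, eq_comm (a := i') (b := i)]
    ring

/-- The gaps factor as κ - f(a) = (1-a)(κ - a(1+a)) and κ + f(a) = (1+a)(κ - a(a-1)), nonnegative
because κ ≥ 2. -/
theorem abs_reaction_le (hκ : 2 ≤ κ) {a : ℝ} (ha : |a| ≤ 1) : |(κ + 1) * a - a ^ 3| ≤ κ := by
  rw [abs_le] at ha ⊢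
  have h1 : 0 ≤ (1 - a) * (κ - a * (1 + a)) :=
    mul_nonneg (by linarith) (by nlinarith)
  have h2 : 0 ≤ (1 + a) * (κ - a * (a - 1)) :=
    mul_nonneg (by linarith) (by nlinarith)
  constructor <;> nlinarith

/-- The form a² + ab + b² lies between 0 and 1 + 7/5 + (7/5)² < 6 ≤ 2(κ+1). This slack lets the
exact solution exceed 1. -/
theorem abs_reaction_sub_le (hκ : 2 ≤ κ) {a b : ℝ} (ha : |a| ≤ 1) (hb : |b| ≤ 7 / 5) :
    |((κ + 1) * a - a ^ 3) - ((κ + 1) * b - b ^ 3)| ≤ (κ + 1) * |a - b| := by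
  have h1 : ((κ + 1) * a - a ^ 3) - ((κ + 1) * b - b ^ 3)
      = (κ + 1 - (a ^ 2 + a * b + b ^ 2)) * (a - b) := by ring
  rw [h1, abs_mul]
  refine mul_le_mul_of_nonneg_right ?_ (abs_nonneg _)
  rw [abs_le] at ha hb ⊢
  constructor <;> nlinarith [sq_nonneg (a + b), sq_nonneg (a - b)]

/-- A cruder constant suffices for the exact solution at two times, since it multiplies only an O(τ)
difference and never the error. -/
theorem abs_reaction_sub_le_of_bound (hκ : 2 ≤ κ) {a b M : ℝ} (ha : |a| ≤ M) (hb : |b| ≤ M) :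
    |((κ + 1) * a - a ^ 3) - ((κ + 1) * b - b ^ 3)| ≤ (κ + 1 + 3 * M ^ 2) * |a - b| := by
  have h1 : ((κ + 1) * a - a ^ 3) - ((κ + 1) * b - b ^ 3)
      = (κ + 1 - (a ^ 2 + a * b + b ^ 2)) * (a - b) := by ring
  rw [h1, abs_mul]
  refine mul_le_mul_of_nonneg_right ?_ (abs_nonneg _)
  have h2 := sq_le_sq' (abs_le.1 ha).1 (abs_le.1 ha).2
  have h3 := sq_le_sq' (abs_le.1 hb).1 (abs_le.1 hb).2
  rw [abs_le]
  constructor <;> nlinarith [sq_nonneg (a + b), sq_nonneg (a - b)]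

/-- The iterates of the scheme are bounded by one. -/
theorem IsKernel.norm_etd1_le_one (H : IsKernel d δ ρ) (hκ : 2 ≤ κ) {X τ : ℝ} (hτ : 0 ≤ τ) {N : ℕ}
    [NeZero N] {u₀ : Sp d → ℝ} (h0 : ‖restrict X N u₀‖ ≤ 1) (n : ℕ) :
    ‖etd1 X ε κ δ ρ N τ u₀ n‖ ≤ 1 := by
  induction n with
  | zero => exact h0
  | succ n ih =>
    simp only [etd1, ← smul_neg]
    set U := etd1 X ε κ δ ρ N τ u₀ n
    have hF : ‖fVec κ U‖ ≤ κ := (pi_norm_le_iff_of_nonneg (by linarith)).2 fun i =>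
      abs_reaction_le hκ ((norm_le_pi_norm U i).trans ih)
    -- Comparison with the zero curve: e^{-κτ} + ((1 - e^{-κτ})/κ)·κ = 1.
    have h1 := exponential_step_error (by linarith : 0 < κ)
      (fun t ht v => H.norm_exp_Lh_mulVec_le (ε := ε) (κ := κ) (X / N) N ht v) hτ
      (w := fun _ => 0) (w' := fun _ => 0) continuousOn_const continuousOn_const
      (fun s _ => hasDerivAt_const s 0) U (fVec κ U) (B := κ) (fun s _ => by simpa using hF)
    rw [sub_zero, sub_zero, div_mul_cancel₀ _ (by linarith)] at h1
    refine h1.trans ?_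
    nlinarith [Real.exp_pos (-(κ * τ))]

end MaximumPrinciple

/-! ### Restriction of periodic functions to the grid -/

section Restriction

open scoped Matrix

variable {d : ℕ} {X : ℝ}

theorem node_apply (X : ℝ) (N : ℕ) (i : Grid d N) (k : Fin d) :
    node X N i k = X / N * ((i k).val : ℝ) := by
  simp [node, meshPt]

/-- Reducing an index modulo N moves the point by a multiple of N·(X/N) = X in that coordinate,
which periodicity absorbs. -/
theorem restrict_add (hX : 0 < X) (u : C4per d X) (N : ℕ) [NeZero N] (i : Grid d N)
    (j : Fin d → ℤ) :
    restrict X N u (i + fun k => (j k : ZMod N)) = u (node X N i + meshPt (X / N) j) := by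
  have hN : (N : ℝ) ≠ 0 := by exact_mod_cast NeZero.ne N
  have hdvd : ∀ k, ∃ m : ℤ, (((i k + (j k : ZMod N)).val : ℕ) : ℤ)
      = ((i k).val : ℤ) + j k + N * m := fun k => by
    have h1 : (((((i k + (j k : ZMod N)).val : ℕ) : ℤ) : ZMod N))
        = ((((i k).val : ℤ) + j k : ℤ) : ZMod N) := by simp
    obtain ⟨m, hm⟩ := (ZMod.intCast_eq_intCast_iff_dvd_sub _ _ N).1 h1.symm
    exact ⟨m, by linarith⟩
  choose m hm using hdvd
  rw [restrict, ← add_lattice u.2.2 m (node X N i + meshPt (X / N) j)]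
  refine congrArg u.1 ?_
  ext k
  have h2 : (((i k + (j k : ZMod N)).val : ℕ) : ℝ) = ((i k).val : ℝ) + j k + N * m k := by
    exact_mod_cast hm k
  have h3 : (∑ k, m k • EuclideanSpace.single k X : Sp d) k = m k * X := by
    simp [Finset.sum_apply, Pi.single_apply]
  rw [PiLp.add_apply, PiLp.add_apply, h3, node_apply, node_apply, meshPt_apply, Pi.add_apply, h2]
  field_simp

theorem meshPt_neg (h : ℝ) (j : Fin d → ℤ) : meshPt h (-j) = -meshPt h j := by
  ext k
  simp [meshPt]

theorem stiffness_mulVec_restrict (hX : 0 < X) (δ : ℝ) (ρ : ℝ → ℝ) (u : C4per d X) (N : ℕ)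
    [NeZero N] (i : Grid d N) :
    (stiffness (X / N) δ ρ N *ᵥ restrict X N u) i
      = ∑ j ∈ stencil d (X / N) δ, coeff (X / N) δ ρ j *
        (u (node X N i + meshPt (X / N) j) + u (node X N i - meshPt (X / N) j)
          - 2 * u (node X N i)) := by
  rw [stiffness_mulVec]
  refine Finset.sum_congr rfl fun j _ => ?_
  have h1 : (i - fun k => (j k : ZMod N)) = i + fun k => ((-j) k : ZMod N) := by
    funext k
    simp [sub_eq_add_neg]
  rw [h1, restrict_add hX, restrict_add hX, meshPt_neg, ← sub_eq_add_neg]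
  rfl

theorem node_mem_closedCube (hX : 0 < X) (N : ℕ) [NeZero N] (i : Grid d N) :
    node X N i ∈ closedCube d X := fun k => by
  have hN : (0 : ℝ) < N := by exact_mod_cast NeZero.pos N
  have h1 : ((i k).val : ℝ) ≤ N := by exact_mod_cast (ZMod.val_lt (i k)).le
  rw [node_apply]
  refine ⟨by positivity, ?_⟩
  calc X / N * (i k).val ≤ X / N * N := by gcongr
    _ = X := by field_simp

theorem closedCube_subset_closure_cube (hX : 0 < X) : closedCube d X ⊆ closure (cube d X) := by
  intro x hx
  let c : Sp d := WithLp.toLp 2 fun _ => X / 2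
  have hcont : Continuous fun θ : ℝ => x + θ • (c - x) := by fun_prop
  have h1 : Filter.Tendsto (fun θ : ℝ => x + θ • (c - x)) (nhdsWithin 0 (Ioi 0)) (nhds x) := by
    have := hcont.tendsto 0
    rw [zero_smul, add_zero] at this
    exact this.mono_left nhdsWithin_le_nhds
  refine mem_closure_of_tendsto h1 ?_
  filter_upwards [Ioo_mem_nhdsGT (zero_lt_one (α := ℝ))] with θ hθ k
  have h2 : (x + θ • (c - x)) k = (1 - θ) * x k + θ * (X / 2) := by
    simp [c]
    ring
  rw [h2]
  have h3 := mul_pos hθ.1 (half_pos hX)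
  have h4 := mul_nonneg (sub_nonneg.2 hθ.2.le) (hx k).1
  have h5 := mul_le_mul_of_nonneg_left (hx k).2 (sub_nonneg.2 hθ.2.le)
  constructor <;> nlinarith [mul_pos hθ.1 hX]

variable [hX : Fact (0 < X)]

theorem abs_apply_le (u : C4per d X) (x : Sp d) : |u x| ≤ ‖u‖ := by
  have h1 := (norm_le_iff u (norm_nonneg u)).1 le_rfl 0 (by norm_num) x
  rwa [norm_iteratedFDeriv_zero] at h1

/-- Evaluation at a point, as a bounded functional on `C⁴_per`. -/
noncomputable def evalCLM (x : Sp d) : C4per d X →L[ℝ] ℝ :=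
  LinearMap.mkContinuous
    { toFun := fun u => u x
      map_add' := fun _ _ => rfl
      map_smul' := fun _ _ => rfl } 1
    fun u => by rw [one_mul]; exact abs_apply_le u x

/-- Restriction to the grid, as a bounded operator on `C⁴_per`. -/
noncomputable def restrictCLM (N : ℕ) : C4per d X →L[ℝ] (Grid d N → ℝ) :=
  ContinuousLinearMap.pi fun i => evalCLM (node X N i)

theorem norm_restrict_le (N : ℕ) [NeZero N] (u : C4per d X) : ‖restrict X N u‖ ≤ ‖u‖ :=
  (pi_norm_le_iff_of_nonneg (norm_nonneg _)).2 fun i => abs_apply_le u (node X N i)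

end Restriction

/-! ### The error of the scheme -/

section Error

open scoped Matrix

variable {d : ℕ} {X : ℝ} [hX : Fact (0 < X)] {T ε δ κ M τ : ℝ} {ρ : ℝ → ℝ} {u₀ : Sp d → ℝ}
  {u : ℝ → C4per d X}

namespace IsSolution

variable (S : IsSolution T ε δ ρ u₀ u)

include S

theorem hasDerivAt {t : ℝ} (ht : t ∈ Ioo 0 T) :
    HasDerivAt u (derivWithin u (Icc 0 T) t) t :=
  ((S.regular.differentiableOn one_ne_zero) t (Ioo_subset_Icc_self ht)).hasDerivWithinAt.hasDerivAt
    (Icc_mem_nhds ht.1 ht.2)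

/-- The exact solution satisfies the difference equation up to `O(h²)` on the closed cube. -/
theorem truncation_le (hd : 0 < d) (H : IsKernel d δ ρ) (hM : C1NormLE T u M) {h : ℝ}
    (hh : 0 < h) {t : ℝ} (ht : t ∈ Ioo 0 T) {x : Sp d} (hx : x ∈ closedCube d X) :
    |derivWithin u (Icc 0 T) t x - (ε ^ 2 * ∑ j ∈ stencil d h δ, coeff h δ ρ j *
        (u t (x + meshPt h j) + u t (x - meshPt h j) - 2 * u t x) - u t x ^ 3 + u t x)|
      ≤ ε ^ 2 * (98 * d ^ 3 * M * h ^ 2) := by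
  have hc : Continuous (u t).1 := (u t).2.1.continuous
  have hc' : Continuous (derivWithin u (Icc 0 T) t).1 :=
    (derivWithin u (Icc 0 T) t).2.1.continuous
  have hclosed : IsClosed {x : Sp d | |derivWithin u (Icc 0 T) t x -
      (ε ^ 2 * ∑ j ∈ stencil d h δ, coeff h δ ρ j *
        (u t (x + meshPt h j) + u t (x - meshPt h j) - 2 * u t x) - u t x ^ 3 + u t x)|
      ≤ ε ^ 2 * (98 * d ^ 3 * M * h ^ 2)} :=
    isClosed_le (by fun_prop) continuous_const
  -- The equation is given only in the open cube, while nodes with a zero index lie on its boundary.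
  -- The inequality involves only finite sums of continuous functions, so it extends to the closure.
  refine closure_minimal (fun y hy => ?_) hclosed (closedCube_subset_closure_cube hX.out hx)
  have h1 : HasDerivAt (fun s => u s y) (derivWithin u (Icc 0 T) t y) t :=
    (evalCLM y).hasFDerivAt.comp_hasDerivAt t (S.hasDerivAt ht)
  have h2 := h1.unique (S.equation y hy t ht)
  have hMt := (hM t (Ioo_subset_Icc_self ht)).1
  have h3 := H.consistency hd hh (u t).2.1
    ((norm_le_iff (u t) ((norm_nonneg _).trans hMt)).1 hMt 4 le_rfl) y
  rw [mem_ofPred_eq, h2]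
  rw [abs_sub_comm] at h3
  calc _ = |ε ^ 2 * (nonlocalOp δ ρ (u t) y - ∑ j ∈ stencil d h δ, coeff h δ ρ j *
        (u t (y + meshPt h j) + u t (y - meshPt h j) - 2 * u t y))| := by congr 1; ring
    _ ≤ _ := by
      rw [abs_mul, abs_of_nonneg (sq_nonneg ε)]
      exact mul_le_mul_of_nonneg_left h3 (sq_nonneg ε)

theorem norm_sub_le (hM : C1NormLE T u M) {a b : ℝ} (ha : a ∈ Icc 0 T) (hb : b ∈ Icc 0 T) :
    ‖u b - u a‖ ≤ M * |b - a| :=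
  (convex_Icc 0 T).norm_image_sub_le_of_norm_derivWithin_le
    (S.regular.differentiableOn one_ne_zero) (fun t ht => (hM t ht).2) ha hb

/-- One step of the scheme: error propagation. -/
theorem step_error (hd : 0 < d) (H : IsKernel d δ ρ) (hM : C1NormLE T u M) (hκ : 2 ≤ κ)
    (N : ℕ) [NeZero N] {a : ℝ} (ha : 0 ≤ a) (hτ : 0 < τ) (haT : a + τ ≤ T) {U : Grid d N → ℝ}
    (hU : ‖U‖ ≤ 1) (hw : ‖restrict X N (u a)‖ ≤ 7 / 5) :
    ‖NormedSpace.exp (τ • (-Lh ε κ (X / N) δ ρ N)) *ᵥ U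
        + (∫ s in (0 : ℝ)..τ, NormedSpace.exp ((τ - s) • (-Lh ε κ (X / N) δ ρ N)) *ᵥ fVec κ U)
        - restrict X N (u (a + τ))‖
      ≤ (1 + τ) * ‖U - restrict X N (u a)‖
        + τ * (ε ^ 2 * (98 * d ^ 3 * M * (X / N) ^ 2) + (κ + 1 + 3 * M ^ 2) * (M * τ)) := by
  have hT : 0 < T := by linarith
  set u' : ℝ → C4per d X := derivWithin u (Icc 0 T) with hu'
  have hh : 0 < X / N := div_pos hX.out (by exact_mod_cast NeZero.pos N)
  have haI : a ∈ Icc 0 T := ⟨ha, by linarith⟩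
  have hM0 : 0 ≤ M := (norm_nonneg _).trans (hM a haI).1
  have hmaps : MapsTo (fun s => a + s) (Icc 0 τ) (Icc 0 T) := fun s hs =>
    ⟨by linarith [hs.1], by linarith [hs.2]⟩
  have hshift : ContinuousOn (fun s : ℝ => a + s) (Icc 0 τ) := by fun_prop
  set R := ε ^ 2 * (98 * d ^ 3 * M * (X / N) ^ 2) + (κ + 1 + 3 * M ^ 2) * (M * τ) with hR
  set e := ‖U - restrict X N (u a)‖ with he
  have hR0 : 0 ≤ R := by positivity
  have h1 := exponential_step_error (by linarith : 0 < κ)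
    (fun t ht v => H.norm_exp_Lh_mulVec_le (ε := ε) (κ := κ) (X / N) N ht v) hτ.le
    (w := fun s => restrict X N (u (a + s)))
    (w' := fun s => restrict X N (u' (a + s)))
    ((restrictCLM N).continuous.comp_continuousOn (S.regular.continuousOn.comp hshift hmaps))
    ((restrictCLM N).continuous.comp_continuousOn
      ((S.regular.continuousOn_derivWithin (uniqueDiffOn_Icc hT) le_rfl).comp hshift hmaps))
    (fun s hs => by
      have h2 : HasDerivAt u (u' (a + s)) (a + s) :=
        S.hasDerivAt ⟨by linarith [hs.1], by linarith [hs.2]⟩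
      exact (restrictCLM N).hasFDerivAt.comp_hasDerivAt s (h2.comp_const_add a s))
    -- The residual has three parts: the propagated error (κ+1)e, the freezing of f at the start of
    -- the step, and the spatial truncation; R collects the last two.
    U (fVec κ U) (B := (κ + 1) * e + R) fun s hs => by
      have ht : a + s ∈ Ioo 0 T := ⟨by linarith [hs.1], by linarith [hs.2]⟩
      refine (pi_norm_le_iff_of_nonneg (by positivity)).2 fun i => ?_
      set x := node X N i with hx
      have hi : (Lh ε κ (X / N) δ ρ N *ᵥ restrict X N (u (a + s))) i
          = -(ε ^ 2) * (∑ j ∈ stencil d (X / N) δ, coeff (X / N) δ ρ j *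
            (u (a + s) (x + meshPt (X / N) j) + u (a + s) (x - meshPt (X / N) j)
              - 2 * u (a + s) x)) + κ * u (a + s) x := by
        rw [Lh, Matrix.add_mulVec, Matrix.smul_mulVec, Matrix.smul_mulVec, Matrix.one_mulVec,
          Pi.add_apply, Pi.smul_apply, Pi.smul_apply, stiffness_mulVec_restrict hX.out]
        rfl
      have t1 := S.truncation_le hd H hM hh ht (node_mem_closedCube hX.out N i)
      rw [← hx, ← hu'] at t1
      have t2 : |((κ + 1) * U i - U i ^ 3) - ((κ + 1) * u a x - u a x ^ 3)| ≤ (κ + 1) * e := by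
        refine (abs_reaction_sub_le hκ ((norm_le_pi_norm U i).trans hU)
          ((norm_le_pi_norm (restrict X N (u a)) i).trans hw)).trans ?_
        exact mul_le_mul_of_nonneg_left
          (norm_le_pi_norm (U - restrict X N (u a)) i) (by linarith)
      have t3 : |((κ + 1) * u a x - u a x ^ 3)
          - ((κ + 1) * u (a + s) x - u (a + s) x ^ 3)| ≤ (κ + 1 + 3 * M ^ 2) * (M * τ) := by
        refine (abs_reaction_sub_le_of_bound hκ ((abs_apply_le _ x).trans (hM a haI).1)
          ((abs_apply_le _ x).trans (hM _ (Ioo_subset_Icc_self ht)).1)).trans ?_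
        refine mul_le_mul_of_nonneg_left ?_ (by positivity)
        refine (abs_apply_le (u a - u (a + s)) x).trans
          ((S.norm_sub_le hM (Ioo_subset_Icc_self ht) haI).trans ?_)
        refine mul_le_mul_of_nonneg_left ?_ hM0
        rw [sub_add_cancel_left, abs_neg, abs_of_pos hs.1]
        exact hs.2.le
      have hval : (fVec κ U - (restrict X N (u' (a + s))
            + Lh ε κ (X / N) δ ρ N *ᵥ restrict X N (u (a + s)))) i
          = (((κ + 1) * U i - U i ^ 3) - ((κ + 1) * u a x - u a x ^ 3))
            + (((κ + 1) * u a x - u a x ^ 3) - ((κ + 1) * u (a + s) x - u (a + s) x ^ 3))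
            - (u' (a + s) x
              - (ε ^ 2 * ∑ j ∈ stencil d (X / N) δ, coeff (X / N) δ ρ j *
              (u (a + s) (x + meshPt (X / N) j) + u (a + s) (x - meshPt (X / N) j)
                - 2 * u (a + s) x) - u (a + s) x ^ 3 + u (a + s) x)) := by
        rw [Pi.sub_apply, Pi.add_apply, hi, fVec, restrict]
        ring
      rw [hval, Real.norm_eq_abs]
      refine (abs_sub _ _).trans ((add_le_add ((abs_add_le _ _).trans (add_le_add t2 t3)) t1).trans
        (le_of_eq ?_))
      rw [hR]
      ring
  simp only [add_zero] at h1
  refine h1.trans ?_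
  -- In terms of θ ≤ τ the contraction factor is 1 - κθ, so κ cancels and the error is multiplied by
  -- 1 + θ.
  set θ := (1 - Real.exp (-(κ * τ))) / κ with hθ
  have hκ0 : 0 < κ := by linarith
  have hθ1 : Real.exp (-(κ * τ)) = 1 - κ * θ := by
    rw [hθ]
    field_simp
    ring
  have hθ2 : θ ≤ τ := by
    rw [hθ, div_le_iff₀ hκ0]
    linarith [Real.add_one_le_exp (-(κ * τ))]
  have he0 : 0 ≤ e := norm_nonneg _
  rw [hθ1]
  calc (1 - κ * θ) * e + θ * ((κ + 1) * e + R) = (1 + θ) * e + θ * R := by ring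
    _ ≤ _ := by gcongr

end IsSolution

/-- The global error estimate, as long as the bound is small. -/
theorem IsSolution.error_le_of_small (S : IsSolution T ε δ ρ u₀ u) (hd : 0 < d)
    (H : IsKernel d δ ρ) (hM : C1NormLE T u M) (hκ : 2 ≤ κ)
    (h0 : ∀ x ∈ closedCube d X, |u₀ x| ≤ 1) (N : ℕ) [NeZero N] (hτ : 0 < τ) {C : ℝ}
    (hC : ε ^ 2 * (98 * d ^ 3 * M) + (κ + 1 + 3 * M ^ 2) * M ≤ C)
    (n : ℕ) (hn : n * τ ≤ T)
    (hsmall : C * Real.exp (n * τ) * ((X / N) ^ 2 + τ) ≤ 2 / 5) :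
    ‖etd1 X ε κ δ ρ N τ u₀ n - restrict X N (u (n * τ))‖
      ≤ C * (Real.exp (n * τ) - 1) * ((X / N) ^ 2 + τ) := by
  have hnode : ‖restrict X N u₀‖ ≤ 1 := (pi_norm_le_iff_of_nonneg zero_le_one).2 fun i =>
    h0 _ (node_mem_closedCube hX.out N i)
  have hT : 0 ≤ T := le_trans (by positivity) hn
  have hM0 : 0 ≤ M := (norm_nonneg _).trans (hM 0 ⟨le_rfl, hT⟩).1
  have hC0 : 0 ≤ C := le_trans (by positivity) hC
  set q := (X / N) ^ 2 + τ with hq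
  have hq0 : 0 ≤ q := by positivity
  induction n with
  | zero =>
    have h1 : restrict X N u₀ = restrict X N (u 0) := funext fun i =>
      (S.initial _ (node_mem_closedCube hX.out N i)).symm
    simp [etd1, h1]
  | succ n ih =>
    have hn1 : ((n + 1 : ℕ) : ℝ) * τ = n * τ + τ := by push_cast; ring
    rw [hn1] at hn hsmall ⊢
    have hexp : Real.exp (n * τ) ≤ Real.exp (n * τ + τ) := Real.exp_le_exp.2 (by linarith)
    have hsmall' : C * Real.exp (n * τ) * q ≤ 2 / 5 := le_trans (by gcongr) hsmall
    have ih' := ih (by linarith) hsmall'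
    set U := etd1 X ε κ δ ρ N τ u₀ n with hU
    have hU1 : ‖U‖ ≤ 1 := H.norm_etd1_le_one hκ hτ.le hnode n
    -- The bootstrap: iterates bounded by 1 and an error of at most 2/5 keep the exact solution
    -- within 7/5 at the nodes.
    have hw : ‖restrict X N (u (n * τ))‖ ≤ 7 / 5 := by
      have h2 := norm_sub_norm_le (restrict X N (u (n * τ))) U
      rw [norm_sub_rev] at h2
      nlinarith [mul_nonneg hC0 hq0]
    have h3 := S.step_error hd H hM hκ N (by positivity) hτ hn hU1 hw
    simp only [etd1, ← smul_neg]
    refine h3.trans ?_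
    have hR : ε ^ 2 * (98 * d ^ 3 * M * (X / N) ^ 2) + (κ + 1 + 3 * M ^ 2) * (M * τ) ≤ C * q := by
      refine le_trans ?_ (mul_le_mul_of_nonneg_right hC hq0)
      have e1 : 0 ≤ ε ^ 2 * (98 * d ^ 3 * M) * τ := by positivity
      have e2 : 0 ≤ (κ + 1 + 3 * M ^ 2) * M * (X / N) ^ 2 := by positivity
      rw [hq]
      linarith
    have hE : (1 + τ) * Real.exp (n * τ) ≤ Real.exp (n * τ + τ) := by
      rw [Real.exp_add, mul_comm]
      exact mul_le_mul_of_nonneg_left (by linarith [Real.add_one_le_exp τ]) (Real.exp_pos _).le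
    -- The -1 in the induction bound absorbs the source: (1+τ)(e^{t_n} - 1) + τ = (1+τ)e^{t_n} - 1.
    calc _ ≤ (1 + τ) * (C * (Real.exp (n * τ) - 1) * q) + τ * (C * q) := by gcongr
      _ = C * ((1 + τ) * Real.exp (n * τ) - 1) * q := by ring
      _ ≤ _ := by gcongr

end Error

end NAC

theorem mainTheorem3 (d : ℕ) (hd : 0 < d) (ε κ M : ℝ) (hε : 0 < ε) (hκ : 2 ≤ κ) :
    ∃ C : ℝ, 0 < C ∧
      ∀ (X : ℝ) [Fact (0 < X)] (T δ : ℝ) (ρ : ℝ → ℝ) (u₀ : NAC.Sp d → ℝ)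
        (u : ℝ → NAC.C4per d X),
        0 < T → 0 < δ → NAC.IsKernel d δ ρ →
        NAC.IsSolution T ε δ ρ u₀ u → NAC.C1NormLE T u M →
        (∀ x ∈ NAC.closedCube d X, |u₀ x| ≤ 1) →
        ∀ (N K : ℕ) [NeZero N], 0 < K → ∀ (h τ : ℝ), h = X / N → τ = T / K →
          ∀ n ≤ K,
            ‖NAC.etd1 X ε κ δ ρ N τ u₀ n - NAC.restrict X N (u (n * τ))‖
              ≤ C * Real.exp (n * τ) * (h ^ 2 + τ) := by
  -- The constant is chosen before `M` is known to be nonnegative, hence the absolute values; the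
  -- final 1 makes it positive.
  set C₀ := ε ^ 2 * (98 * d ^ 3 * |M|) + (κ + 1 + 3 * |M| ^ 2) * |M| + 1 with hC₀
  have hC₀pos : 0 < C₀ := by positivity
  refine ⟨C₀ * (5 / 2 * (1 + |M|)), by positivity, ?_⟩
  intro X _ T δ ρ u₀ u hT _ H S hM h0 N K _ hK h τ hh hτ n hn
  have hX : 0 < X := Fact.out
  have hK' : (0 : ℝ) < K := by exact_mod_cast hK
  have hτ0 : 0 < τ := by rw [hτ]; positivity
  have hnT : n * τ ≤ T := by
    have h1 : (n : ℝ) ≤ K := by exact_mod_cast hn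
    calc n * τ ≤ K * τ := by gcongr
      _ = T := by rw [hτ]; field_simp
  have hM0 : 0 ≤ M := (norm_nonneg _).trans (hM 0 ⟨le_rfl, hT.le⟩).1
  rw [abs_of_nonneg hM0] at hC₀ ⊢
  rw [hh]
  set q := (X / N) ^ 2 + τ with hq
  have hq0 : 0 < q := by positivity
  have hb : 0 < C₀ * Real.exp (n * τ) * q := by positivity
  rcases le_or_gt (C₀ * Real.exp (n * τ) * q) (2 / 5) with hs | hs
  · have h1 := S.error_le_of_small hd H hM hκ h0 N hτ0 (C := C₀) (by linarith) n hnT hs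
    have h2 : 0 < C₀ * q := by positivity
    nlinarith
  -- Here C₀e^{t_n}q > 2/5, so the factor (5/2)(1+M) lifts the bound above 1+M, which dominates the
  -- error trivially.
  · have hnode : ‖NAC.restrict X N u₀‖ ≤ 1 := (pi_norm_le_iff_of_nonneg zero_le_one).2 fun i =>
      h0 _ (NAC.node_mem_closedCube hX N i)
    have h1 := H.norm_etd1_le_one (ε := ε) hκ hτ0.le hnode n
    have h2 := (NAC.norm_restrict_le N (u (n * τ))).trans (hM (n * τ) ⟨by positivity, hnT⟩).1
    have h3 := norm_sub_le (NAC.etd1 X ε κ δ ρ N τ u₀ n) (NAC.restrict X N (u (n * τ)))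
    nlinarith
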